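/- Let $n\in\mathbb{N}$. A prefix machine is a partial computable function on $\{0,1\}^*$ whose domain is prefix-free. Fix a universal prefix machine $U$, i.e. a prefix machine such that for every prefix machine $M$ there is a constant $c_M$ such that, whenever $M(\pi)=w$, there is $\pi'$ with $U(\pi')=w$ and $|\pi'|\le|\pi|+c_M$. For $w\in\{0,1\}^*$ let $K(w)=\min\{|\pi| : U(\pi)=w\}$, and extend $K$ to $\mathbb{N}$ and $\mathbb{Q}^n$ by standard binary encodings. For $E\subseteq\mathbb{R}^n$ let $K(E)=\min\{K(q) : q\in E\cap\mathbb{Q}^n\}$ (with $\min\emptyset=\infty$), and let $\kappa(E)=2^{-K(E)}$ (with $2^{-\infty}=0$); $\kappa$ is an outer measure on $\mathbb{R}^n$. An outer measure $\mu:\mathcal{P}(\mathbb{R}^n)\to[0,\infty]$ is *strongly finite* if $\mu(\mathbb{R}^n\setminus\mathbb{Q}^n)=0$ and $\sum_{q\in\mathbb{Q}^n}\mu(\{q\})<\infty$. It is *lower semicomputable* if (a) for every $\varepsilon>0$ there is a finite set $A\subseteq\mathbb{Q}^n$ with $\mu(\mathbb{R}^n\setminus A)<\varepsilon$, and (b)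 there is a computable function $\hat\mu$, taking a finite set $A\subseteq\mathbb{Q}^n$ and $t\in\mathbb{N}$ to a rational number $\hat\mu(A,t)\ge 0$, such that $\hat\mu(A,s)\le\hat\mu(A,t)\le\mu(A)$ whenever $s\le t$, and $\lim_{t\to\infty}\hat\mu(A,t)=\mu(A)$ for every $A$. For $r\in\mathbb{N}$ and $m\in\mathbb{Z}^n$, the $r$-dyadic cube with address $m$ is $2^{-r}\cdot\prod_{i=1}^n[m_i,m_i+1)$; let $\mathcal{Q}^{(r)}$ be the set of all $r$-dyadic cubes. An outer measure $\mu$ *dominates* $\nu$ on dyadic cubes *with factor* $\beta:\mathbb{N}\to(0,\infty)$ if $\beta(r)=2^{-o(r)}$ as $r\to\infty$ and $\mu(Q)\ge\beta(r)\,\nu(Q)$ for all $r\in\mathbb{N}$ and $Q\in\mathcal{Q}^{(r)}$. It is *locally optimal* if it is strongly finite and lower semicomputable and, for every strongly finite, lower semicomputable outer measure $\nu$ on $\mathbb{R}^n$, it dominates $\nu$ on dyadic cubes with some factor $\beta$. **Theorem.** The outer measure $\kappa$ on $\mathbb{R}^n$ is locally optimal. Moreover, there is a constant $c\in\mathbb{N}$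 such that for every strongly finite, lower semicomputable outer measure $\nu$ on $\mathbb{R}^n$ there is $\alpha\in(0,\infty)$ such that $\kappa$ dominates $\nu$ on dyadic cubes with factor $\beta(r)=\alpha\cdot 2^{-(K(r)+c)}$. -/

import Mathlib

open MeasureTheory Filter Topology Asymptotics
open scoped NNReal ENNReal

namespace KolmogorovOuter

/-! ### Prefix machines and prefix Kolmogorov complexity -/

/-- A prefix machine: a partial computable function on binary strings whose domain is
prefix-free. -/
structure IsPrefixMachine (M : List Bool →. List Bool) : Prop where
  partrec : Partrec M
  prefixFree : ∀ π π' : List Bool, (M π).Dom → (M π').Dom → π <+: π' → π = π'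

/-- `U` is a universal prefix machine: it simulates every prefix machine `M` with programs that
are longer by at most an additive constant depending on `M`. (If each `M` is simulated through
`U (σ ++ π) = M π` for a fixed string `σ`, this holds with the length of `σ` as the constant.) -/
structure IsUniversalPrefixMachine (U : List Bool →. List Bool) : Prop where
  isPrefixMachine : IsPrefixMachine U
  simulates : ∀ M : List Bool →. List Bool, IsPrefixMachine M →
    ∃ c : ℕ, ∀ π w : List Bool, w ∈ M π →
      ∃ π' : List Bool, w ∈ U π' ∧ π'.length ≤ π.length + c

/-- `K(w)`, the minimal length of a program that makes `U` output the string `w`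
(`⊤` if there is none, which does not happen for universal `U`). -/
noncomputable def stringComplexity (U : List Bool →. List Bool) (w : List Bool) : ℕ∞ :=
  ⨅ (π : List Bool) (_ : w ∈ U π), (π.length : ℕ∞)

/-- The standard binary encoding of an effectively coded countable type. -/
def binaryCode {α : Type} [Primcodable α] (a : α) : List Bool :=
  Nat.bits (Encodable.encode a)

/-- A rational number, coded as its reduced numerator and denominator. -/
def ratCode (q : ℚ) : ℤ × ℕ := (q.num, q.den)

/-- A rational point, coded coordinatewise. -/
def pointCode {n : ℕ} (q : Fin n → ℚ) : Fin n → ℤ × ℕ := fun i => ratCode (q i)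

/-- `K(r)` for a natural number `r`. -/
noncomputable def natComplexity (U : List Bool →. List Bool) (r : ℕ) : ℕ∞ :=
  stringComplexity U (binaryCode r)

/-- `K(q)` for a rational point `q`. -/
noncomputable def pointComplexity (U : List Bool →. List Bool) {n : ℕ} (q : Fin n → ℚ) : ℕ∞ :=
  stringComplexity U (binaryCode (pointCode q))

/-- The inclusion of `ℚⁿ` in `ℝⁿ`. -/
noncomputable def ratPoint {n : ℕ} (q : Fin n → ℚ) : EuclideanSpace ℝ (Fin n) :=
  WithLp.toLp 2 (fun i => (q i : ℝ))

/-- `K(E)`, the least complexity of a rational point of `E`; it is `⊤` if `E` has none. -/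
noncomputable def setComplexity (U : List Bool →. List Bool) {n : ℕ}
    (E : Set (EuclideanSpace ℝ (Fin n))) : ℕ∞ :=
  ⨅ (q : Fin n → ℚ) (_ : ratPoint q ∈ E), pointComplexity U q

/-- `2 ^ (-k)`, with `2 ^ (-∞) = 0`. -/
noncomputable def twoPowNeg : ℕ∞ → ℝ≥0
  | ⊤ => 0
  | (k : ℕ) => (2⁻¹ : ℝ≥0) ^ k

theorem twoPowNeg_top : twoPowNeg ⊤ = 0 := rfl

theorem twoPowNeg_coe (k : ℕ) : twoPowNeg (k : ℕ∞) = (2⁻¹ : ℝ≥0) ^ k := rfl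

theorem twoPowNeg_antitone : Antitone twoPowNeg := by
  intro a b hab
  induction b using ENat.recTopCoe with
  | top => rw [twoPowNeg_top]; exact zero_le
  | coe b =>
    induction a using ENat.recTopCoe with
    | top => simp at hab
    | coe a =>
      rw [twoPowNeg_coe, twoPowNeg_coe]
      exact pow_le_pow_of_le_one zero_le (by norm_num [inv_le_one_iff₀]) (by exact_mod_cast hab)

theorem setComplexity_anti (U : List Bool →. List Bool) {n : ℕ}
    {E F : Set (EuclideanSpace ℝ (Fin n))} (h : E ⊆ F) :
    setComplexity U F ≤ setComplexity U E :=
  le_iInf₂ fun q hq => iInf₂_le q (h hq)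

theorem setComplexity_iUnion_attained (U : List Bool →. List Bool) {n : ℕ}
    (E : ℕ → Set (EuclideanSpace ℝ (Fin n))) :
    setComplexity U (⋃ i, E i) = ⊤ ∨ ∃ i, setComplexity U (E i) ≤ setComplexity U (⋃ i, E i) := by
  by_cases h : setComplexity U (⋃ i, E i) = ⊤
  · exact Or.inl h
  · refine Or.inr ?_
    by_contra! hlt
    have key : setComplexity U (⋃ i, E i) + 1 ≤ setComplexity U (⋃ i, E i) := by
      conv_rhs => unfold setComplexity
      refine le_iInf₂ fun q hq => ?_
      obtain ⟨i, hi⟩ := Set.mem_iUnion.1 hq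
      exact Order.add_one_le_of_lt ((hlt i).trans_le (iInf₂_le q hi))
    exact absurd ((ENat.add_one_le_iff h).1 key) (lt_irrefl _)

/-- The outer measure `κ(E) = 2 ^ (-K(E))` on `ℝⁿ`. -/
noncomputable def kappa (U : List Bool →. List Bool) (n : ℕ) :
    OuterMeasure (EuclideanSpace ℝ (Fin n)) where
  measureOf E := (twoPowNeg (setComplexity U E) : ℝ≥0∞)
  empty := by
    have : setComplexity U (∅ : Set (EuclideanSpace ℝ (Fin n))) = ⊤ := by
      simp [setComplexity]
    rw [this, twoPowNeg_top, ENNReal.coe_zero]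
  mono h := ENNReal.coe_le_coe.2 (twoPowNeg_antitone (setComplexity_anti U h))
  iUnion_nat E _ := by
    rcases setComplexity_iUnion_attained U E with h | ⟨i, hi⟩
    · rw [h, twoPowNeg_top, ENNReal.coe_zero]; exact zero_le
    · exact (ENNReal.coe_le_coe.2 (twoPowNeg_antitone hi)).trans
        (ENNReal.le_tsum (f := fun i => (twoPowNeg (setComplexity U (E i)) : ℝ≥0∞)) i)

/-! ### Properties of outer measures on `ℝⁿ` -/

/-- `μ` is supported on `ℚⁿ`. -/
def IsSupportedOnRat {n : ℕ} (μ : OuterMeasure (EuclideanSpace ℝ (Fin n))) : Prop :=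
  μ (Set.range (ratPoint (n := n)))ᶜ = 0

/-- `μ` is finitely supported on `ℚⁿ`. -/
def IsFinitelySupportedOnRat {n : ℕ} (μ : OuterMeasure (EuclideanSpace ℝ (Fin n))) : Prop :=
  ∀ ε : ℝ≥0, 0 < ε → ∃ A : Finset (Fin n → ℚ), μ (ratPoint '' (A : Set (Fin n → ℚ)))ᶜ < ε

/-- `μ` is strongly finite: supported on `ℚⁿ`, with summable point masses there. -/
def IsStronglyFinite {n : ℕ} (μ : OuterMeasure (EuclideanSpace ℝ (Fin n))) : Prop :=
  IsSupportedOnRat μ ∧ ∑' q : Fin n → ℚ, μ {ratPoint q} < ∞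

/-- Computability of a function of a finite set of rational points and a natural number, with
nonnegative rational values: an algorithm takes any list of the elements of the set to the reduced
fraction of the value. -/
def IsComputableOnFinsets {n : ℕ} (f : Finset (Fin n → ℚ) → ℕ → ℚ≥0) : Prop :=
  ∃ F : List (Fin n → ℤ × ℕ) → ℕ → ℤ × ℕ, Computable₂ F ∧
    ∀ (l : List (Fin n → ℚ)) (t : ℕ), F (l.map pointCode) t = ratCode (f l.toFinset t : ℚ)

/-- `μ` is lower semicomputable: finitely supported on `ℚⁿ`, and its values on finite sets of
rational points are limits of a computable nondecreasing sequence of lower bounds. -/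
def IsLowerSemicomputable {n : ℕ} (μ : OuterMeasure (EuclideanSpace ℝ (Fin n))) : Prop :=
  IsFinitelySupportedOnRat μ ∧
    ∃ f : Finset (Fin n → ℚ) → ℕ → ℚ≥0, IsComputableOnFinsets f ∧
      (∀ (A : Finset (Fin n → ℚ)) (s t : ℕ), s ≤ t →
        f A s ≤ f A t ∧ ((f A t : ℝ≥0) : ℝ≥0∞) ≤ μ (ratPoint '' (A : Set (Fin n → ℚ)))) ∧
      ∀ A : Finset (Fin n → ℚ),
        Tendsto (fun t => ((f A t : ℝ≥0) : ℝ≥0∞)) atTop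
          (𝓝 (μ (ratPoint '' (A : Set (Fin n → ℚ)))))

/-! ### Dyadic cubes, domination and local optimality -/

/-- The half-open unit cube at `m`. -/
def unitCube {n : ℕ} (m : Fin n → ℤ) : Set (EuclideanSpace ℝ (Fin n)) :=
  {x | ∀ i, (m i : ℝ) ≤ x i ∧ x i < (m i : ℝ) + 1}

/-- The `r`-dyadic cube with address `m`. -/
def dyadicCube {n : ℕ} (r : ℕ) (m : Fin n → ℤ) : Set (EuclideanSpace ℝ (Fin n)) :=
  (fun x => ((2 : ℝ) ^ r)⁻¹ • x) '' unitCube m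

/-- The family of all `r`-dyadic cubes. -/
def dyadicCubes (n : ℕ) (r : ℕ) : Set (Set (EuclideanSpace ℝ (Fin n))) :=
  Set.range (dyadicCube r)

/-- `μ` dominates `ν` on the families `𝒜 r` with factor `β : ℕ → (0, ∞)`, where
`β r = 2 ^ (-o(r))`. -/
def DominatesWith {n : ℕ} (β : ℕ → ℝ≥0) (μ ν : OuterMeasure (EuclideanSpace ℝ (Fin n)))
    (𝒜 : ℕ → Set (Set (EuclideanSpace ℝ (Fin n)))) : Prop :=
  (∀ r, 0 < β r) ∧
  (∃ g : ℕ → ℝ, g =o[atTop] (fun r : ℕ => (r : ℝ)) ∧ ∀ r, (β r : ℝ) = (2 : ℝ) ^ (-g r)) ∧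
  ∀ r, ∀ E ∈ 𝒜 r, (β r : ℝ≥0∞) * ν E ≤ μ E

/-- `μ` dominates `ν` on the families `𝒜 r`. -/
def Dominates {n : ℕ} (μ ν : OuterMeasure (EuclideanSpace ℝ (Fin n)))
    (𝒜 : ℕ → Set (Set (EuclideanSpace ℝ (Fin n)))) : Prop :=
  ∃ β : ℕ → ℝ≥0, DominatesWith β μ ν 𝒜

/-- Local optimality of an outer measure on `ℝⁿ`. -/
def IsLocallyOptimal {n : ℕ} (μ : OuterMeasure (EuclideanSpace ℝ (Fin n))) : Prop :=
  (IsStronglyFinite μ ∧ IsLowerSemicomputable μ) ∧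
  ∀ ν : OuterMeasure (EuclideanSpace ℝ (Fin n)),
    IsStronglyFinite ν → IsLowerSemicomputable ν → Dominates μ ν (dyadicCubes n)

end KolmogorovOuter

/-!
If `ν` is strongly finite and lower semicomputable, then `2 ^ (-k) < ν Q` is semidecidable in the
exponent `k` and the dyadic cube `Q`, uniformly in the level `r`. The cubes of one level are
disjoint, so their `ν`-masses have a sum that is bounded independently of the level. Consider the
requests for a program of length `|π| + k` for the least corner of `Q`, one for each program
`π` for `r` and each `k` with `2 ^ (-k) < ν Q`. They can be enumerated, and their total weight
`2 ^ (-length)` is finite because the programs of a prefix machine satisfy Kraft's inequality. By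
the Kraft–Chaitin theorem the requests are met up to an additive constant, so the corner, which is
a rational point of `Q`, has complexity at most `K(r) - log₂ (ν Q) + O(1)`. Finally `K(r) = o(r)`
since the binary expansion of `r` has length `O(log r)`.
-/

namespace KolmogorovOuter

/-! ### Primitive recursive functions on integers and bit strings -/

section Primrec

variable {α σ : Type} [Primcodable α] [Primcodable σ]

theorem primrec_intEquivNatSumNat : Primrec Equiv.intEquivNatSumNat :=
  Primrec.encode_iff.1 (Primrec.encode.of_eq fun z => by cases z <;> rfl)

theorem primrec_int_casesOn {f : α → ℤ} {g h : α → ℕ → σ} (hf : Primrec f) (hg : Primrec₂ g)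
    (hh : Primrec₂ h) :
    Primrec fun a => (Int.casesOn (f a) (g a) (h a) : σ) :=
  (Primrec.sumCasesOn (primrec_intEquivNatSumNat.comp hf) hg hh).of_eq fun a => by
    cases f a <;> rfl

theorem primrec_intEquivNatSumNat_symm : Primrec Equiv.intEquivNatSumNat.symm :=
  Primrec.encode_iff.1 (Primrec.encode.of_eq fun x => by cases x <;> rfl)

theorem primrec_int_ofNat : Primrec Int.ofNat :=
  primrec_intEquivNatSumNat_symm.comp Primrec.sumInl

theorem primrec_int_negSucc : Primrec Int.negSucc :=
  primrec_intEquivNatSumNat_symm.comp Primrec.sumInr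

theorem primrec_int_toNat : Primrec Int.toNat :=
  (primrec_int_casesOn Primrec.id Primrec₂.right (Primrec₂.const 0)).of_eq fun z => by
    cases z <;> rfl

theorem primrec_int_natAbs : Primrec Int.natAbs :=
  (primrec_int_casesOn Primrec.id Primrec₂.right (Primrec.succ.comp₂ Primrec₂.right)).of_eq
    fun z => by cases z <;> rfl

theorem primrec_int_mul_nat : Primrec₂ fun (a : ℤ) (b : ℕ) => a * b := by
  have hpos : Primrec₂ fun (x : ℤ × ℕ) (k : ℕ) => Int.ofNat (k * x.2) :=
    primrec_int_ofNat.comp (Primrec.nat_mul.comp Primrec.snd (Primrec.snd.comp Primrec.fst))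
  have hneg : Primrec₂ fun (x : ℤ × ℕ) (k : ℕ) =>
      if x.2 = 0 then Int.ofNat 0 else Int.negSucc ((k + 1) * x.2 - 1) :=
    Primrec.ite (Primrec.eq.comp (Primrec.snd.comp Primrec.fst) (Primrec.const 0))
      (Primrec.const _) (primrec_int_negSucc.comp (Primrec.pred.comp
        (Primrec.nat_mul.comp (Primrec.succ.comp Primrec.snd) (Primrec.snd.comp Primrec.fst))))
  refine (primrec_int_casesOn Primrec.fst hpos hneg).of_eq ?_
  rintro ⟨k | k, b⟩
  · rfl
  · rcases b with - | b
    · simp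
    · have : 1 ≤ (k + 1) * (b + 1) := Nat.mul_pos k.succ_pos b.succ_pos
      simp only [Nat.add_one_ne_zero, if_false, Int.negSucc_eq]
      push_cast [this]
      ring

theorem primrec_int_div_nat : Primrec₂ fun (a : ℤ) (b : ℕ) => a / b := by
  have hpos : Primrec₂ fun (x : ℤ × ℕ) (k : ℕ) => Int.ofNat (k / x.2) :=
    primrec_int_ofNat.comp (Primrec.nat_div.comp Primrec.snd (Primrec.snd.comp Primrec.fst))
  have hneg : Primrec₂ fun (x : ℤ × ℕ) (k : ℕ) =>
      if x.2 = 0 then Int.ofNat 0 else Int.negSucc (k / x.2) :=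
    Primrec.ite (Primrec.eq.comp (Primrec.snd.comp Primrec.fst) (Primrec.const 0))
      (Primrec.const _) (primrec_int_negSucc.comp
        (Primrec.nat_div.comp Primrec.snd (Primrec.snd.comp Primrec.fst)))
  refine (primrec_int_casesOn Primrec.fst hpos hneg).of_eq ?_
  rintro ⟨k | k, b⟩
  · rfl
  · rcases b with - | b
    · simp
    · rfl

theorem primrec_nat_pow : Primrec₂ ((· ^ ·) : ℕ → ℕ → ℕ) :=
  Primrec₂.unpaired'.1 Nat.Primrec.pow

theorem primrec_nat_gcd : Primrec₂ Nat.gcd := by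
  have hdvd : PrimrecRel ((· ∣ ·) : ℕ → ℕ → Prop) :=
    (Primrec.eq.comp (Primrec.nat_mod.comp Primrec.snd Primrec.fst) (Primrec.const 0)).of_eq
      fun x => (Nat.dvd_iff_mod_eq_zero ..).symm
  have hcommon : PrimrecRel fun (x : ℕ × ℕ) (d : ℕ) => d ∣ x.1 ∧ d ∣ x.2 :=
    (hdvd.comp Primrec.snd (Primrec.fst.comp Primrec.fst)).and
      (hdvd.comp Primrec.snd (Primrec.snd.comp Primrec.fst))
  refine ((Primrec.nat_findGreatest
    (Primrec.nat_add.comp Primrec.fst Primrec.snd) hcommon)).of_eq ?_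
  rintro ⟨a, b⟩
  refine Nat.findGreatest_eq_iff.2 ⟨?_, fun _ => ⟨Nat.gcd_dvd_left a b, Nat.gcd_dvd_right a b⟩, ?_⟩
  · rcases Nat.eq_zero_or_pos a with rfl | ha
    · simp
    · exact (Nat.gcd_le_left b ha).trans (Nat.le_add_right a b)
  · rintro d hd hle ⟨ha, hb⟩
    rcases Nat.eq_zero_or_pos (a.gcd b) with h0 | hpos
    · obtain ⟨rfl, rfl⟩ := Nat.gcd_eq_zero_iff.1 h0
      omega
    · exact hd.not_ge (Nat.le_of_dvd hpos (Nat.dvd_gcd ha hb))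

theorem nat_bits_eq_cons {n : ℕ} (hn : n ≠ 0) : n.bits = n.bodd :: n.div2.bits := by
  have h := Nat.bodd_add_div2 n
  conv_lhs => rw [← Nat.bit_bodd_div2 n]
  refine Nat.bits_append_bit _ _ fun h0 => ?_
  cases hb : n.bodd
  · simp_all
  · rfl

theorem primrec_nat_bits : Primrec Nat.bits := by
  have hstep : Primrec₂ fun (_ : Unit) (l : List (List Bool)) =>
      if l.length = 0 then some [] else (l[l.length.div2]?).map (l.length.bodd :: ·) :=
    Primrec.ite (Primrec.eq.comp (Primrec.list_length.comp Primrec.snd) (Primrec.const 0))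
      (Primrec.const _)
      (Primrec.option_map
        (Primrec.list_getElem?.comp Primrec.snd
          (Primrec.nat_div2.comp (Primrec.list_length.comp Primrec.snd)))
        (Primrec.list_cons.comp
          (Primrec.nat_bodd.comp (Primrec.list_length.comp (Primrec.snd.comp Primrec.fst)))
          Primrec.snd))
  refine (Primrec.nat_strong_rec (fun (_ : Unit) n => Nat.bits n) hstep fun _ n => ?_).comp
    (Primrec.const ()) Primrec.id
  rcases eq_or_ne n 0 with rfl | hn
  · simp
  · have hlt : n.div2 < n := by rw [Nat.div2_val]; omega
    simp [hn, hlt, nat_bits_eq_cons hn]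

theorem primrec_binaryCode : Primrec (binaryCode (α := α)) :=
  primrec_nat_bits.comp Primrec.encode

theorem nat_bits_injective : Function.Injective Nat.bits := by
  intro a
  induction a using Nat.strong_induction_on with
  | _ a ih =>
    intro b h
    rcases eq_or_ne a 0 with rfl | ha
    · have hsize := congrArg List.length h
      rw [Nat.size_eq_bits_len, Nat.size_eq_bits_len, Nat.size_zero] at hsize
      exact (Nat.size_eq_zero.1 hsize.symm).symm
    · have hbodd : a.bodd = b.bodd := by rw [Nat.bodd_eq_bits_head, Nat.bodd_eq_bits_head, h]
      have hdiv2 : a.div2 = b.div2 := by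
        refine ih a.div2 (by rw [Nat.div2_val]; omega) ?_
        rw [Nat.div2_bits_eq_tail, Nat.div2_bits_eq_tail, h]
      rw [← Nat.bit_bodd_div2 a, ← Nat.bit_bodd_div2 b, hbodd, hdiv2]

theorem binaryCode_injective : Function.Injective (binaryCode (α := α)) :=
  nat_bits_injective.comp Encodable.encode_injective

end Primrec

/-! ### Recursively enumerable predicates -/

section REPred

variable {α β σ : Type} [Primcodable α] [Primcodable β] [Primcodable σ]

theorem exists_primrecRel_of_rePred {p : α → Prop} (hp : REPred p) :
    ∃ D : α → ℕ → Prop, PrimrecRel D ∧ ∀ a, p a ↔ ∃ t, D a t := by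
  obtain ⟨c, hc⟩ := Nat.Partrec.Code.exists_code.1 hp
  refine ⟨fun a t => (Nat.Partrec.Code.evaln t c (Encodable.encode a)).isSome,
    Primrec.primrecPred (Primrec.option_isSome.comp (Nat.Partrec.Code.primrec_evaln.comp
      ((Primrec.snd.pair (Primrec.const c)).pair (Primrec.encode.comp Primrec.fst)))
        |>.of_eq fun _ => by simp), fun a => ?_⟩
  have hdom : p a ↔ (Nat.Partrec.Code.eval c (Encodable.encode a)).Dom := by
    simp [hc, Part.assert]
  simp only [hdom, Part.dom_iff_mem, Nat.Partrec.Code.evaln_complete, Option.isSome_iff_exists,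
    Option.mem_def]
  exact exists_comm

theorem rePred_and {p q : α → Prop} (hp : REPred p) (hq : REPred q) :
    REPred fun a => p a ∧ q a := by
  have hq' : Partrec₂ fun (a : α) (_ : Unit) => Part.assert (q a) fun _ => Part.some () :=
    Partrec.comp hq Computable.fst
  refine (Partrec.bind hp hq').dom_re.of_eq fun a => ?_
  simp [Part.assert, Part.bind_dom]

theorem rePred_comp {p : β → Prop} (hp : REPred p) {f : α → β} (hf : Computable f) :
    REPred fun a => p (f a) :=
  Partrec.comp hp hf

theorem rePred_exists {p : α → β → Prop} (hp : REPred fun x : α × β => p x.1 x.2) :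
    REPred fun a => ∃ b, p a b := by
  classical
  obtain ⟨D, hD, h⟩ := exists_primrecRel_of_rePred hp
  have hsearch : Primrec₂ fun (a : α) (i : ℕ) => (Encodable.decode (α := β × ℕ) i).bind fun x =>
      if D (a, x.1) x.2 then some () else none := by
    refine Primrec.option_bind (Primrec.decode.comp Primrec.snd)
      (Primrec.ite (PrimrecRel.comp hD ?_ (Primrec.snd.comp Primrec.snd))
        (Primrec.const _) (Primrec.const _))
    exact (Primrec.fst.comp Primrec.fst).pair (Primrec.fst.comp Primrec.snd)
  refine (Partrec.rfindOpt hsearch.to_comp).dom_re.of_eq fun a => ?_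
  simp only [Nat.rfindOpt_dom, Option.mem_def, Option.bind_eq_some_iff,
    Option.ite_none_right_eq_some]
  constructor
  · rintro ⟨-, -, ⟨b, t⟩, -, hb, -⟩
    exact ⟨b, (h (a, b)).2 ⟨t, hb⟩⟩
  · rintro ⟨b, hb⟩
    obtain ⟨t, ht⟩ := (h (a, b)).1 hb
    exact ⟨Encodable.encode (b, t), (), (b, t), Encodable.encodek _, ht, trivial⟩

theorem rePred_mem_partrec {f : α →. β} (hf : Partrec f) :
    REPred fun x : α × β => x.2 ∈ f x.1 := by
  classical
  have heq : Partrec₂ fun (x : α × β) (b : β) => Part.assert (b = x.2) fun _ => Part.some () :=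
    (Primrec.eq.comp Primrec.snd (Primrec.snd.comp Primrec.fst)).computablePred.to_re
  refine (Partrec.bind (hf.comp Computable.fst) heq).dom_re.of_eq fun x => ?_
  simp [Part.assert, Part.dom_iff_mem]

theorem rePred_image {p : α → Prop} (hp : REPred p) {f : α → β} (hf : Computable f) :
    REPred fun b => ∃ a, p a ∧ f a = b :=
  rePred_exists (p := fun b a => p a ∧ f a = b) (rePred_and (rePred_comp hp Computable.snd)
    (rePred_comp Primrec.eq.computablePred.to_re
      ((hf.comp Computable.snd).pair Computable.fst)))

theorem exists_injective_primrec_enumeration {p : α → Prop} (hp : REPred p) :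
    ∃ e : ℕ → Option α, Primrec e ∧ (∀ i j a, e i = some a → e j = some a → i = j) ∧
      ∀ a, p a ↔ ∃ i, e i = some a := by
  classical
  obtain ⟨D, hD, h⟩ := exists_primrecRel_of_rePred hp
  -- To avoid repetitions, `a` is output only at the code of the pair of `a` and its first witness.
  let first : ℕ → α × ℕ → Prop := fun i x =>
    Encodable.encode x = i ∧ D x.1 x.2 ∧ ∀ s < x.2, ¬ D x.1 s
  have hfirst : PrimrecRel first := by
    refine (Primrec.eq.comp (Primrec.encode.comp Primrec.snd) Primrec.fst).and
      ((PrimrecRel.comp hD (Primrec.fst.comp Primrec.snd) (Primrec.snd.comp Primrec.snd)).and ?_)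
    exact ((PrimrecRel.forall_mem_list (R := fun s (a : α) => ¬ D a s)
      (PrimrecRel.comp hD Primrec.snd Primrec.fst).not).comp
      (Primrec.list_range.comp (Primrec.snd.comp Primrec.snd))
      (Primrec.fst.comp Primrec.snd)).of_eq fun x => by simp
  let e : ℕ → Option α := fun i =>
    (Encodable.decode (α := α × ℕ) i).bind fun x => if first i x then some x.1 else none
  have he : ∀ i a, e i = some a ↔ ∃ t, first i (a, t) := by
    intro i a
    simp only [e, Option.bind_eq_some_iff, Option.ite_none_right_eq_some, Option.some.injEq]
    constructor
    · rintro ⟨⟨a, t⟩, -, hx, rfl⟩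
      exact ⟨t, hx⟩
    · rintro ⟨t, ht⟩
      exact ⟨(a, t), ht.1 ▸ Encodable.encodek _, ht, rfl⟩
  refine ⟨e, Primrec.option_bind Primrec.decode (Primrec.ite hfirst
    (Primrec.option_some.comp (Primrec.fst.comp Primrec.snd)) (Primrec.const none)), ?_, ?_⟩
  · intro i j a hi hj
    obtain ⟨s, rfl, hs, hs'⟩ := (he i a).1 hi
    obtain ⟨t, rfl, ht, ht'⟩ := (he j a).1 hj
    rcases lt_trichotomy s t with hst | rfl | hts
    · exact absurd hs (ht' s hst)
    · rfl
    · exact absurd ht (hs' t hts)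
  · intro a
    simp only [he, h]
    constructor
    · intro hex
      exact ⟨_, Nat.find hex, rfl, Nat.find_spec hex, fun s => Nat.find_min hex⟩
    · rintro ⟨_, t, -, ht, -⟩
      exact ⟨t, ht⟩

end REPred

/-! ### The Kraft inequality and algorithmic probability -/

section Kraft

theorem uniquelyDecodable_of_prefixFree {α : Type*} {S : Set (List α)} (hnil : [] ∉ S)
    (hS : ∀ u ∈ S, ∀ v ∈ S, u <+: v → u = v) : InformationTheory.UniquelyDecodable S := by
  have hne : ∀ u ∈ S, ∀ L : List (List α), (u :: L).flatten ≠ [] := fun u hu L h =>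
    hnil ((List.append_eq_nil_iff.1 h).1 ▸ hu)
  intro L₁
  induction L₁ with
  | nil =>
    rintro (- | ⟨v, L₂⟩) - h₂ h
    · rfl
    · exact absurd h.symm (hne v (h₂ v (by simp)) L₂)
  | cons u L₁ ih =>
    rintro (- | ⟨v, L₂⟩) h₁ h₂ h
    · exact absurd h (hne u (h₁ u (by simp)) L₁)
    · have hu : u ∈ S := h₁ u (by simp)
      have hv : v ∈ S := h₂ v (by simp)
      have huv : u = v := by
        rw [List.flatten_cons, List.flatten_cons] at h
        rcases List.prefix_or_prefix_of_prefix (List.prefix_append u L₁.flatten)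
          (h ▸ List.prefix_append v L₂.flatten) with hp | hp
        · exact hS u hu v hv hp
        · exact (hS v hv u hu hp).symm
      subst huv
      rw [ih L₂ (fun w hw => h₁ w (by simp [hw])) (fun w hw => h₂ w (by simp [hw]))
        (List.append_cancel_left h)]

theorem tsum_inv_card_pow_length_le_one_of_prefixFree {α : Type*} [Fintype α] [Nonempty α]
    {S : Set (List α)} (hS : ∀ u ∈ S, ∀ v ∈ S, u <+: v → u = v) :
    ∑' w : S, (Fintype.card α : ℝ≥0∞)⁻¹ ^ (w : List α).length ≤ 1 := by
  by_cases hnil : [] ∈ S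
  · have hS' : S = {[]} :=
      Set.eq_singleton_iff_unique_mem.2 ⟨hnil, fun w hw => (hS _ hnil _ hw List.nil_prefix).symm⟩
    subst hS'
    simp
  · refine ENNReal.summable.tsum_le_of_sum_le fun T => ?_
    have hkraft := InformationTheory.kraft_mcmillan_inequality
      (S := T.map (Function.Embedding.subtype _)) <|
        uniquelyDecodable_of_prefixFree (by simp [hnil]) fun u hu v hv => by
          simp only [Finset.coe_map, Function.Embedding.subtype_apply, Set.mem_image,
            Finset.mem_coe, Subtype.exists, exists_and_right, exists_eq_right] at hu hv
          exact hS u hu.1 v hv.1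
    have hcard : (Fintype.card α : ℝ≥0∞)⁻¹ = ((Fintype.card α : ℝ≥0)⁻¹ : ℝ≥0) := by
      rw [ENNReal.coe_inv (by simp), ENNReal.coe_natCast]
    simp only [Finset.sum_map, Function.Embedding.subtype_apply, one_div] at hkraft
    rw [hcard]
    norm_cast
    rw [← NNReal.coe_le_coe]
    push_cast
    exact hkraft

end Kraft

/-- The algorithmic probability of a string, the a priori probability of Solomonoff and Levin: the
probability that a prefix machine outputs it when fed with fair coin flips. -/
noncomputable def algorithmicProbability (U : List Bool →. List Bool) (w : List Bool) : ℝ≥0∞ :=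
  ∑' π : {π // w ∈ U π}, 2⁻¹ ^ π.1.length

section AlgorithmicProbability

variable {U : List Bool →. List Bool}

theorem IsPrefixMachine.tsum_algorithmicProbability_le_one (hU : IsPrefixMachine U) :
    ∑' w, algorithmicProbability U w ≤ 1 := by
  let program : (Σ w, {π // w ∈ U π}) → {π | (U π).Dom} := fun x =>
    ⟨x.2.1, Part.dom_iff_mem.2 ⟨x.1, x.2.2⟩⟩
  have hprogram : Function.Injective program := by
    rintro ⟨w, π, hw⟩ ⟨w', π', hw'⟩ h
    obtain rfl : π = π' := congrArg Subtype.val h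
    obtain rfl : w = w' := Part.mem_unique hw hw'
    rfl
  calc ∑' w, algorithmicProbability U w
      = ∑' x, (2⁻¹ : ℝ≥0∞) ^ (program x : List Bool).length := by
        rw [ENNReal.tsum_sigma']
        rfl
    _ ≤ ∑' π : {π | (U π).Dom}, (2⁻¹ : ℝ≥0∞) ^ (π : List Bool).length :=
        ENNReal.tsum_comp_le_tsum_of_injective hprogram
          fun π : {π | (U π).Dom} => (2⁻¹ : ℝ≥0∞) ^ (π : List Bool).length
    _ ≤ 1 := by
        simpa using tsum_inv_card_pow_length_le_one_of_prefixFree (S := {π | (U π).Dom})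
          fun u hu v hv => hU.prefixFree u v hu hv

theorem stringComplexity_le {π w : List Bool} (h : w ∈ U π) :
    stringComplexity U w ≤ π.length :=
  iInf₂_le π h

theorem exists_mem_length_eq_stringComplexity {w : List Bool} (h : stringComplexity U w ≠ ⊤) :
    ∃ π, w ∈ U π ∧ π.length = stringComplexity U w := by
  rw [stringComplexity, iInf_subtype'] at h ⊢
  have := ENat.iInf_natCast_ne_top.1 h
  obtain ⟨π, hπ⟩ := ENat.exists_eq_iInf fun π : {π // w ∈ U π} => (π.1.length : ℕ∞)
  exact ⟨π.1, π.2, hπ⟩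

theorem coe_twoPowNeg_natCast (k : ℕ) : (twoPowNeg k : ℝ≥0∞) = 2⁻¹ ^ k := by
  rw [twoPowNeg_coe]
  push_cast
  rfl

theorem twoPowNeg_stringComplexity_le_algorithmicProbability (w : List Bool) :
    twoPowNeg (stringComplexity U w) ≤ algorithmicProbability U w := by
  by_cases h : stringComplexity U w = ⊤
  · simp [h, twoPowNeg_top]
  · obtain ⟨π, hπ, hlen⟩ := exists_mem_length_eq_stringComplexity h
    rw [← hlen, coe_twoPowNeg_natCast]
    exact ENNReal.le_tsum (f := fun π : {π // w ∈ U π} => (2⁻¹ : ℝ≥0∞) ^ π.1.length) ⟨π, hπ⟩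

end AlgorithmicProbability

/-! ### Bit strings as dyadic intervals -/

section DyadicInterval

/-- The dyadic rational `s.1 / 2 ^ s.2`. Dyadic rationals are handled through such pairs so that
they can be compared by a primitive recursive procedure. -/
noncomputable def dyadicValue (s : ℕ × ℕ) : ℝ := s.1 / 2 ^ s.2

theorem dyadicValue_le_dyadicValue {s t : ℕ × ℕ} :
    dyadicValue s ≤ dyadicValue t ↔ s.1 * 2 ^ t.2 ≤ t.1 * 2 ^ s.2 := by
  rw [dyadicValue, dyadicValue, div_le_div_iff₀ (by positivity) (by positivity)]
  exact_mod_cast Iff.rfl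

theorem primrecRel_dyadicValue_le : PrimrecRel fun s t => dyadicValue s ≤ dyadicValue t := by
  have hcross : Primrec₂ fun s t : ℕ × ℕ => s.1 * 2 ^ t.2 :=
    Primrec.nat_mul.comp (Primrec.fst.comp Primrec.fst)
      (primrec_nat_pow.comp (Primrec.const 2) (Primrec.snd.comp Primrec.snd))
  exact (PrimrecRel.comp Primrec.nat_le hcross (hcross.comp Primrec.snd Primrec.fst)).of_eq
    fun _ => dyadicValue_le_dyadicValue.symm

/-- The number with the given binary expansion, most significant digit first. -/
def bitsValue (π : List Bool) : ℕ := π.foldl (fun v b => 2 * v + b.toNat) 0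

theorem primrec_bitsValue : Primrec bitsValue :=
  Primrec.list_foldl (h := fun _ (x : ℕ × Bool) => 2 * x.1 + x.2.toNat) Primrec.id (Primrec.const 0)
    (Primrec.nat_add.comp (Primrec.nat_mul.comp (Primrec.const 2) (Primrec.fst.comp Primrec.snd))
      ((Primrec.dom_bool Bool.toNat).comp (Primrec.snd.comp Primrec.snd)))

theorem bitsValue_concat (π : List Bool) (b : Bool) :
    bitsValue (π ++ [b]) = 2 * bitsValue π + b.toNat := by
  simp [bitsValue]

theorem exists_bitsValue_eq {L x : ℕ} (hx : x < 2 ^ L) : ∃ π, π.length = L ∧ bitsValue π = x := by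
  induction L generalizing x with
  | zero => exact ⟨[], rfl, (Nat.lt_one_iff.1 hx).symm⟩
  | succ L ih =>
    obtain ⟨π, hlen, hval⟩ := ih (x := x / 2) (by rw [pow_succ] at hx; omega)
    refine ⟨π ++ [x.bodd], by simp [hlen], ?_⟩
    rw [bitsValue_concat, hval, ← Nat.div2_val]
    have := Nat.bodd_add_div2 x
    omega

/-- The left end point of the interval `[0.π, 0.π + 2 ^ (-|π|))` of the reals in `[0, 1)` whose
binary expansion extends `π`, as a pair for `dyadicValue`. -/
def intervalLeft (π : List Bool) : ℕ × ℕ := (bitsValue π, π.length)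

/-- The right end point of the interval of the reals in `[0, 1)` whose binary expansion extends
`π`, as a pair for `dyadicValue`. -/
def intervalRight (π : List Bool) : ℕ × ℕ := (bitsValue π + 1, π.length)

theorem primrec_intervalLeft : Primrec intervalLeft :=
  primrec_bitsValue.pair Primrec.list_length

theorem primrec_intervalRight : Primrec intervalRight :=
  (Primrec.succ.comp primrec_bitsValue).pair Primrec.list_length

theorem dyadicValue_intervalRight (π : List Bool) :
    dyadicValue (intervalRight π) = dyadicValue (intervalLeft π) + 2⁻¹ ^ π.length := by
  simp [dyadicValue, intervalLeft, intervalRight, add_div]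

theorem dyadicValue_intervalLeft_lt_intervalRight (π : List Bool) :
    dyadicValue (intervalLeft π) < dyadicValue (intervalRight π) := by
  rw [dyadicValue_intervalRight]
  exact lt_add_of_pos_right _ (by positivity)

theorem interval_subset_of_prefix {π π' : List Bool} (h : π <+: π') :
    dyadicValue (intervalLeft π) ≤ dyadicValue (intervalLeft π') ∧
      dyadicValue (intervalRight π') ≤ dyadicValue (intervalRight π) := by
  obtain ⟨ρ, rfl⟩ := h
  induction ρ using List.reverseRecOn with
  | nil => simp
  | append_singleton ρ b ih =>
    rw [← List.append_assoc]
    have hle : b.toNat ≤ 1 := Bool.toNat_le b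
    refine ⟨ih.1.trans (dyadicValue_le_dyadicValue.2 ?_),
      (dyadicValue_le_dyadicValue.2 ?_).trans ih.2⟩ <;>
    · simp only [intervalLeft, intervalRight, bitsValue_concat, List.length_append (bs := [b]),
        List.length_singleton, pow_succ]
      nlinarith [Nat.zero_le (2 ^ (π ++ ρ).length)]

theorem exists_interval_subset {a : ℝ} (ha : 0 ≤ a) {ℓ : ℕ} (h : a + 2⁻¹ ^ ℓ ≤ 1) :
    ∃ π : List Bool, π.length = ℓ + 1 ∧ a ≤ dyadicValue (intervalLeft π) ∧
      dyadicValue (intervalRight π) ≤ a + 2⁻¹ ^ ℓ := by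
  set x := ⌈a * 2 ^ (ℓ + 1)⌉₊
  have hle : a ≤ x / 2 ^ (ℓ + 1) := by
    rw [le_div_iff₀ (by positivity)]
    exact Nat.le_ceil _
  have hlt : ((x + 1 : ℕ) / 2 ^ (ℓ + 1) : ℝ) < a + 2⁻¹ ^ ℓ := by
    have hceil : (x : ℝ) < a * 2 ^ (ℓ + 1) + 1 := Nat.ceil_lt_add_one (by positivity)
    have hpow : (2⁻¹ : ℝ) ^ ℓ * 2 ^ (ℓ + 1) = 2 := by
      rw [pow_succ, ← mul_assoc, ← mul_pow]
      norm_num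
    rw [div_lt_iff₀ (by positivity), add_mul, hpow]
    push_cast
    linarith
  have hx : x + 1 < 2 ^ (ℓ + 1) := by
    have := hlt.trans_le h
    rw [div_lt_one (by positivity)] at this
    exact_mod_cast this
  obtain ⟨π, hlen, hval⟩ := exists_bitsValue_eq (Nat.lt_of_succ_lt hx)
  refine ⟨π, hlen, ?_, ?_⟩
  · simpa only [dyadicValue, intervalLeft, hlen, hval] using hle
  · simpa only [dyadicValue, intervalRight, hlen, hval] using hlt.le

end DyadicInterval

/-! ### The Kraft–Chaitin theorem -/

/-- The weight `2 ^ (-ℓ)` of a request `(ℓ, w)` for a program of length `ℓ` with output `w`. -/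
noncomputable def requestWeight : Option (ℕ × List Bool) → ℝ≥0
  | none => 0
  | some p => 2⁻¹ ^ p.1

/-- The total weight of the requests before `i`, as a pair for `dyadicValue`. -/
def allocated (e : ℕ → Option (ℕ × List Bool)) : ℕ → ℕ × ℕ
  | 0 => (0, 0)
  | i + 1 => match e i with
    | none => allocated e i
    | some p => ((allocated e i).1 * 2 ^ p.1 + 2 ^ (allocated e i).2, (allocated e i).2 + p.1)

open Classical in
/-- The output of `π` as a program for the request `i`. The request with weight `2 ^ (-ℓ)` owns the
`i`-th of the consecutive intervals with the lengths given by the weights, and it is served by the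
strings of length `ℓ + 1` whose intervals are contained in it. -/
noncomputable def requestOutput (e : ℕ → Option (ℕ × List Bool)) (π : List Bool) (i : ℕ) :
    Option (List Bool) :=
  (e i).bind fun p =>
    if π.length = p.1 + 1 ∧ dyadicValue (allocated e i) ≤ dyadicValue (intervalLeft π) ∧
      dyadicValue (intervalRight π) ≤ dyadicValue (allocated e (i + 1)) then some p.2 else none

section Requests

variable {e : ℕ → Option (ℕ × List Bool)}

theorem dyadicValue_allocated_succ (i : ℕ) :
    dyadicValue (allocated e (i + 1)) = dyadicValue (allocated e i) + requestWeight (e i) := by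
  cases h : e i with
  | none => simp [allocated, h, requestWeight]
  | some p =>
    simp only [allocated, h, requestWeight, dyadicValue]
    push_cast
    rw [pow_add, inv_pow]
    field_simp

theorem dyadicValue_allocated (i : ℕ) :
    dyadicValue (allocated e i) = ∑ j ∈ Finset.range i, (requestWeight (e j) : ℝ) := by
  induction i with
  | zero => simp [dyadicValue, allocated]
  | succ i ih => rw [dyadicValue_allocated_succ, ih, Finset.sum_range_succ]

theorem dyadicValue_allocated_mono : Monotone fun i => dyadicValue (allocated e i) :=
  monotone_nat_of_le_succ fun i => by
    rw [dyadicValue_allocated_succ]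
    exact le_add_of_nonneg_right (NNReal.coe_nonneg _)

theorem requestOutput_eq_some {π w : List Bool} {i : ℕ} :
    requestOutput e π i = some w ↔ ∃ ℓ, e i = some (ℓ, w) ∧ π.length = ℓ + 1 ∧
      dyadicValue (allocated e i) ≤ dyadicValue (intervalLeft π) ∧
      dyadicValue (intervalRight π) ≤ dyadicValue (allocated e (i + 1)) := by
  simp only [requestOutput, Option.bind_eq_some_iff, Option.ite_none_right_eq_some,
    Option.some.injEq, Prod.exists]
  constructor
  · rintro ⟨ℓ, _, he, h, rfl⟩
    exact ⟨ℓ, he, h⟩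
  · rintro ⟨ℓ, he, h⟩
    exact ⟨ℓ, w, he, h, rfl⟩

theorem requestOutput_prefixFree {π π' w w' : List Bool} {i j : ℕ}
    (h : requestOutput e π i = some w) (h' : requestOutput e π' j = some w') (hp : π <+: π') :
    i = j ∧ π = π' := by
  obtain ⟨ℓ, he, hlen, hleft, hright⟩ := requestOutput_eq_some.1 h
  obtain ⟨ℓ', he', hlen', hleft', hright'⟩ := requestOutput_eq_some.1 h'
  obtain ⟨hsub_left, hsub_right⟩ := interval_subset_of_prefix hp
  have hlt := dyadicValue_intervalLeft_lt_intervalRight π'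
  have hij : i = j := by
    rcases lt_trichotomy i j with hij | hij | hij
    · have : dyadicValue (allocated e (i + 1)) ≤ dyadicValue (allocated e j) :=
        dyadicValue_allocated_mono hij
      linarith
    · exact hij
    · have : dyadicValue (allocated e (j + 1)) ≤ dyadicValue (allocated e i) :=
        dyadicValue_allocated_mono hij
      linarith
  subst hij
  obtain rfl : ℓ = ℓ' := congrArg Prod.fst (Option.some.inj (he.symm.trans he'))
  exact ⟨rfl, hp.eq_of_length (hlen.trans hlen'.symm)⟩

theorem exists_requestOutput_eq_some (hsum : ∑' i, (requestWeight (e i) : ℝ≥0∞) ≤ 1) {i ℓ : ℕ}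
    {w : List Bool} (hi : e i = some (ℓ, w)) :
    ∃ π, π.length = ℓ + 1 ∧ requestOutput e π i = some w := by
  have hstep : dyadicValue (allocated e (i + 1)) = dyadicValue (allocated e i) + 2⁻¹ ^ ℓ := by
    rw [dyadicValue_allocated_succ, hi]
    simp [requestWeight]
  have hle : dyadicValue (allocated e (i + 1)) ≤ 1 := by
    have := (ENNReal.sum_le_tsum (Finset.range (i + 1))).trans hsum
    rw [dyadicValue_allocated]
    exact_mod_cast this
  have hnonneg : 0 ≤ dyadicValue (allocated e i) := by unfold dyadicValue; positivity
  obtain ⟨π, hlen, hleft, hright⟩ := exists_interval_subset hnonneg (hstep ▸ hle)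
  exact ⟨π, hlen, requestOutput_eq_some.2 ⟨ℓ, hi, hlen, hleft, hstep ▸ hright⟩⟩

theorem primrec_allocated (he : Primrec e) : Primrec (allocated e) := by
  have hℓ : Primrec fun x : (ℕ × ℕ × ℕ) × ℕ × List Bool => x.2.1 := Primrec.fst.comp Primrec.snd
  have hnum : Primrec fun x : (ℕ × ℕ × ℕ) × ℕ × List Bool => x.1.2.1 :=
    Primrec.fst.comp (Primrec.snd.comp Primrec.fst)
  have hexp : Primrec fun x : (ℕ × ℕ × ℕ) × ℕ × List Bool => x.1.2.2 :=
    Primrec.snd.comp (Primrec.snd.comp Primrec.fst)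
  have hstep : Primrec₂ fun (i : ℕ) (s : ℕ × ℕ) =>
      (Option.casesOn (e i) s
        (fun p : ℕ × List Bool => (s.1 * 2 ^ p.1 + 2 ^ s.2, s.2 + p.1)) : ℕ × ℕ) :=
    Primrec.option_casesOn (he.comp Primrec.fst) Primrec.snd
      ((Primrec.nat_add.comp
        (Primrec.nat_mul.comp hnum (primrec_nat_pow.comp (Primrec.const 2) hℓ))
        (primrec_nat_pow.comp (Primrec.const 2) hexp)).pair (Primrec.nat_add.comp hexp hℓ))
  refine (Primrec.nat_rec₁ (0, 0) hstep).of_eq fun i => ?_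
  induction i with
  | zero => rfl
  | succ i ih =>
    simp only [allocated, ← ih]
    cases e i <;> rfl

theorem primrec_requestOutput (he : Primrec e) : Primrec₂ (requestOutput e) := by
  classical
  have hπ : Primrec fun x : (List Bool × ℕ) × ℕ × List Bool => x.1.1 :=
    Primrec.fst.comp Primrec.fst
  have hi : Primrec fun x : (List Bool × ℕ) × ℕ × List Bool => x.1.2 :=
    Primrec.snd.comp Primrec.fst
  have hlength := Primrec.eq.comp (Primrec.list_length.comp hπ)
    (Primrec.succ.comp (Primrec.fst.comp Primrec.snd))
  have hleft := primrecRel_dyadicValue_le.comp ((primrec_allocated he).comp hi)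
    (primrec_intervalLeft.comp hπ)
  have hright := primrecRel_dyadicValue_le.comp (primrec_intervalRight.comp hπ)
    ((primrec_allocated he).comp (Primrec.succ.comp hi))
  exact Primrec.option_bind (he.comp Primrec.snd) (Primrec.ite (hlength.and (hleft.and hright))
    (Primrec.option_some.comp (Primrec.snd.comp Primrec.snd)) (Primrec.const none))

theorem exists_isPrefixMachine_of_requests (he : Primrec e)
    (hsum : ∑' i, (requestWeight (e i) : ℝ≥0∞) ≤ 1) :
    ∃ M, IsPrefixMachine M ∧
      ∀ i ℓ w, e i = some (ℓ, w) → ∃ π, w ∈ M π ∧ π.length = ℓ + 1 := by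
  refine ⟨fun π => Nat.rfindOpt (requestOutput e π),
    ⟨Partrec.rfindOpt (primrec_requestOutput he).to_comp, ?_⟩, ?_⟩
  · intro π π' h h' hp
    obtain ⟨i, w, hi⟩ := Nat.rfindOpt_dom.1 h
    obtain ⟨j, w', hj⟩ := Nat.rfindOpt_dom.1 h'
    exact (requestOutput_prefixFree hi hj hp).2
  · intro i ℓ w hi
    obtain ⟨π, hlen, hπ⟩ := exists_requestOutput_eq_some hsum hi
    refine ⟨π, ?_, hlen⟩
    obtain ⟨v, hv⟩ := Part.dom_iff_mem.1 (Nat.rfindOpt_dom.2 ⟨i, w, hπ⟩)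
    obtain ⟨j, hj⟩ := Nat.rfindOpt_spec hv
    obtain rfl := (requestOutput_prefixFree hπ hj List.prefix_rfl).1
    exact Option.some.inj (hj.symm.trans hπ) ▸ hv

theorem tsum_requestWeight_le {R : ℕ × List Bool → Prop}
    (hinj : ∀ i j p, e i = some p → e j = some p → i = j) (hR : ∀ i p, e i = some p → R p) :
    ∑' i, (requestWeight (e i) : ℝ≥0∞) ≤ ∑' p : {p // R p}, 2⁻¹ ^ p.1.1 := by
  have hsupport : (Function.support fun i => (requestWeight (e i) : ℝ≥0∞)) ⊆
      {i | ∃ p, e i = some p} := fun i hi => by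
    cases h : e i with
    | none => simp [h, requestWeight] at hi
    | some p => exact ⟨p, h⟩
  choose request hrequest using fun i : {i | ∃ p, e i = some p} => i.2
  let f : {i | ∃ p, e i = some p} → {p // R p} := fun i => ⟨request i, hR i _ (hrequest i)⟩
  have hf : Function.Injective f := fun i j hij => by
    have h : request i = request j := congrArg Subtype.val hij
    exact Subtype.ext (hinj i j _ (hrequest i) (h ▸ hrequest j))
  calc ∑' i, (requestWeight (e i) : ℝ≥0∞)
      = ∑' i : {i | ∃ p, e i = some p}, (requestWeight (e i) : ℝ≥0∞) :=
        (tsum_subtype_eq_of_support_subset hsupport).symm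
    _ = ∑' i, (2⁻¹ : ℝ≥0∞) ^ (f i).1.1 := tsum_congr fun i => by
        simp only [hrequest i, requestWeight, f, ENNReal.coe_pow, ENNReal.coe_inv_two]
    _ ≤ ∑' p : {p // R p}, 2⁻¹ ^ p.1.1 :=
        ENNReal.tsum_comp_le_tsum_of_injective hf fun p : {p // R p} => (2⁻¹ : ℝ≥0∞) ^ p.1.1

end Requests

section KraftChaitin

variable {U : List Bool →. List Bool}

theorem IsUniversalPrefixMachine.exists_stringComplexity_le (hU : IsUniversalPrefixMachine U)
    {R : ℕ × List Bool → Prop} (hR : REPred R)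
    (hsum : ∑' p : {p // R p}, (2⁻¹ : ℝ≥0∞) ^ p.1.1 ≠ ⊤) :
    ∃ c : ℕ, ∀ p, R p → stringComplexity U p.2 ≤ p.1 + c := by
  obtain ⟨e, he, hinj, hmem⟩ := exists_injective_primrec_enumeration hR
  obtain ⟨d, hd⟩ : ∃ d : ℕ, ∑' i, (requestWeight (e i) : ℝ≥0∞) ≤ 2 ^ d := by
    obtain ⟨d, hd⟩ := ENNReal.exists_nat_gt hsum
    refine ⟨d, (tsum_requestWeight_le hinj fun i p h => (hmem p).2 ⟨i, h⟩).trans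
      (hd.le.trans ?_)⟩
    exact_mod_cast Nat.lt_two_pow_self.le
  let lengthen : ℕ × List Bool → ℕ × List Bool := fun p => (p.1 + d, p.2)
  have hlengthen : Primrec lengthen :=
    (Primrec.nat_add.comp Primrec.fst (Primrec.const d)).pair Primrec.snd
  have hweight : ∀ o, requestWeight (o.map lengthen) = 2⁻¹ ^ d * requestWeight o := by
    rintro (- | p) <;> simp [requestWeight, lengthen, pow_add, mul_comm]
  have hle : ∑' i, (requestWeight ((e i).map lengthen) : ℝ≥0∞) ≤ 1 := by
    simp only [hweight, ENNReal.coe_mul, ENNReal.tsum_mul_left]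
    calc _ ≤ (((2⁻¹ : ℝ≥0) ^ d : ℝ≥0) : ℝ≥0∞) * 2 ^ d := by gcongr
      _ = ((2⁻¹ ^ d * 2 ^ d : ℝ≥0) : ℝ≥0∞) := by push_cast; rfl
      _ = 1 := by simp
  obtain ⟨M, hM, hserve⟩ := exists_isPrefixMachine_of_requests
    (Primrec.option_map he (hlengthen.comp₂ Primrec₂.right)) hle
  obtain ⟨c, hc⟩ := hU.simulates M hM
  refine ⟨d + 1 + c, fun p hp => ?_⟩
  obtain ⟨i, hi⟩ := (hmem p).1 hp
  obtain ⟨π, hπ, hlen⟩ := hserve i (p.1 + d) p.2 (by simp [hi, lengthen])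
  obtain ⟨π', hπ', hlen'⟩ := hc π p.2 hπ
  refine (stringComplexity_le hπ').trans ?_
  exact_mod_cast (by omega : π'.length ≤ p.1 + (d + 1 + c))

theorem IsUniversalPrefixMachine.exists_stringComplexity_le_of_computable
    (hU : IsUniversalPrefixMachine U) {ι : Type} [Primcodable ι] {P : ι → Prop} (hP : REPred P)
    {f : ι → ℕ × List Bool} (hf : Computable f)
    (hsum : ∑' i : {i // P i}, (2⁻¹ : ℝ≥0∞) ^ (f i).1 ≠ ⊤) :
    ∃ c : ℕ, ∀ i, P i → stringComplexity U (f i).2 ≤ (f i).1 + c := by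
  choose index hindex using fun p : {p // ∃ i, P i ∧ f i = p} => p.2
  have hinj : Function.Injective fun p => (⟨index p, (hindex p).1⟩ : {i // P i}) := fun p q h => by
    have : index p = index q := congrArg Subtype.val h
    exact Subtype.ext ((hindex p).2.symm.trans (this ▸ (hindex q).2))
  have hle : ∑' p : {p // ∃ i, P i ∧ f i = p}, (2⁻¹ : ℝ≥0∞) ^ p.1.1 ≤
      ∑' i : {i // P i}, 2⁻¹ ^ (f i).1 := by
    simpa only [(hindex _).2] using
      ENNReal.tsum_comp_le_tsum_of_injective hinj fun i => (2⁻¹ : ℝ≥0∞) ^ (f i).1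
  obtain ⟨c, hc⟩ := hU.exists_stringComplexity_le (rePred_image hP hf)
    (ne_top_of_le_ne_top hsum hle)
  exact ⟨c, fun i hi => hc (f i) ⟨i, hi, rfl⟩⟩

end KraftChaitin

section ComplexityBounds

variable {U : List Bool →. List Bool}

theorem tsum_inv_two_pow_two_mul_length_ne_top :
    ∑' w : List Bool, (2⁻¹ : ℝ≥0∞) ^ (2 * w.length) ≠ ⊤ := by
  have hterm : ∀ n : ℕ, ∑' _ : Fin n → Bool, (2⁻¹ : ℝ≥0∞) ^ (2 * n) = 2⁻¹ ^ n := fun n => by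
    rw [tsum_fintype, Finset.sum_const, Finset.card_univ, Fintype.card_fun, Fintype.card_bool,
      Fintype.card_fin, nsmul_eq_mul, two_mul, pow_add, Nat.cast_pow, Nat.cast_ofNat, ← mul_assoc,
      ← mul_pow, ENNReal.mul_inv_cancel (by norm_num) (by norm_num), one_pow, one_mul]
  calc ∑' w : List Bool, (2⁻¹ : ℝ≥0∞) ^ (2 * w.length)
      = ∑' (n : ℕ) (_ : Fin n → Bool), 2⁻¹ ^ (2 * n) := by
        rw [← List.equivSigmaTuple.symm.tsum_eq, ENNReal.tsum_sigma']
        simp only [List.equivSigmaTuple, Equiv.coe_fn_symm_mk, List.length_ofFn]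
    _ = ∑' n : ℕ, 2⁻¹ ^ n := tsum_congr hterm
    _ ≠ ⊤ := by simp

theorem IsUniversalPrefixMachine.exists_stringComplexity_le_two_mul_length
    (hU : IsUniversalPrefixMachine U) :
    ∃ c : ℕ, ∀ w, stringComplexity U w ≤ (2 * w.length + c : ℕ) := by
  have hcode : Primrec fun w : List Bool => (2 * w.length, w) :=
    (Primrec.nat_mul.comp (Primrec.const 2) Primrec.list_length).pair Primrec.id
  have hsum : ∑' w : {_w : List Bool // True}, (2⁻¹ : ℝ≥0∞) ^ (2 * w.1.length) ≠ ⊤ :=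
    ne_top_of_le_ne_top tsum_inv_two_pow_two_mul_length_ne_top
      (ENNReal.tsum_comp_le_tsum_of_injective Subtype.val_injective _)
  obtain ⟨c, hc⟩ := hU.exists_stringComplexity_le_of_computable
    (Primrec.const true).primrecPred.computablePred.to_re hcode.to_comp hsum
  exact ⟨c, fun w => by exact_mod_cast hc w trivial⟩

theorem IsUniversalPrefixMachine.stringComplexity_ne_top (hU : IsUniversalPrefixMachine U)
    (w : List Bool) : stringComplexity U w ≠ ⊤ := by
  obtain ⟨c, hc⟩ := hU.exists_stringComplexity_le_two_mul_length
  exact ((hc w).trans_lt (ENat.natCast_lt_top _)).ne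

theorem length_binaryCode_nat_le (r : ℕ) : (binaryCode r).length ≤ Nat.log 2 r + 1 := by
  rw [binaryCode, Encodable.encode_nat, Nat.size_eq_bits_len, Nat.size_le]
  exact Nat.lt_pow_succ_log_self one_lt_two r

theorem isLittleO_natLog : (fun r : ℕ => (Nat.log 2 r : ℝ)) =o[atTop] fun r : ℕ => (r : ℝ) := by
  have hlogb : (fun r : ℕ => Real.logb 2 r) =o[atTop] fun r : ℕ => (r : ℝ) := by
    simp only [Real.logb, div_eq_inv_mul]
    exact (Real.isLittleO_log_id_atTop.comp_tendsto tendsto_natCast_atTop_atTop).const_mul_left _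
  refine (IsBigO.of_norm_le fun r => ?_).trans_isLittleO hlogb
  rw [Real.norm_natCast]
  exact Real.natLog_le_logb r 2

theorem IsUniversalPrefixMachine.isLittleO_natComplexity (hU : IsUniversalPrefixMachine U) :
    (fun r : ℕ => ((natComplexity U r).toNat : ℝ)) =o[atTop] fun r : ℕ => (r : ℝ) := by
  obtain ⟨c, hc⟩ := hU.exists_stringComplexity_le_two_mul_length
  have hbound : (fun r : ℕ => 2 * (Nat.log 2 r : ℝ) + (2 + c)) =o[atTop] fun r : ℕ => (r : ℝ) :=
    (isLittleO_natLog.const_mul_left 2).add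
      ((isLittleO_const_id_atTop (2 + c : ℝ)).comp_tendsto tendsto_natCast_atTop_atTop)
  refine (IsBigO.of_norm_le fun r => ?_).trans_isLittleO hbound
  have hlog : (natComplexity U r).toNat ≤ 2 * Nat.log 2 r + (2 + c) :=
    (ENat.toNat_le_of_le_natCast (hc _)).trans (by have := length_binaryCode_nat_le r; omega)
  rw [Real.norm_natCast]
  exact_mod_cast hlog

end ComplexityBounds

/-! ### The coding theorem -/

section Coding

variable {U : List Bool →. List Bool}

theorem tsum_inv_two_pow_lt_le (x : ℝ≥0∞) :
    ∑' k : {k : ℕ // (2⁻¹ : ℝ≥0∞) ^ k < x}, (2⁻¹ : ℝ≥0∞) ^ k.1 ≤ 2 * x := by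
  classical
  by_cases h : ∃ k : ℕ, (2⁻¹ : ℝ≥0∞) ^ k < x
  · let shift : {k : ℕ // (2⁻¹ : ℝ≥0∞) ^ k < x} → ℕ := fun k => k.1 - Nat.find h
    have hshift : ∀ k, k.1 = shift k + Nat.find h := fun k =>
      (Nat.sub_add_cancel (Nat.find_min' h k.2)).symm
    have hinj : Function.Injective shift := fun k l hkl =>
      Subtype.ext ((hshift k).trans (hkl ▸ (hshift l).symm))
    calc ∑' k : {k : ℕ // (2⁻¹ : ℝ≥0∞) ^ k < x}, (2⁻¹ : ℝ≥0∞) ^ k.1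
        = ∑' k, (2⁻¹ : ℝ≥0∞) ^ shift k * 2⁻¹ ^ Nat.find h :=
          tsum_congr fun k => by rw [← pow_add, ← hshift]
      _ ≤ ∑' k : ℕ, 2⁻¹ ^ k * 2⁻¹ ^ Nat.find h :=
          ENNReal.tsum_comp_le_tsum_of_injective hinj fun k => (2⁻¹ : ℝ≥0∞) ^ k * 2⁻¹ ^ Nat.find h
      _ = 2 * 2⁻¹ ^ Nat.find h := by
          rw [ENNReal.tsum_mul_right, ENNReal.tsum_geometric, ENNReal.one_sub_inv_two, inv_inv]
      _ ≤ 2 * x := by gcongr; exact (Nat.find_spec h).le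
  · have : IsEmpty {k : ℕ // (2⁻¹ : ℝ≥0∞) ^ k < x} := ⟨fun k => h ⟨k.1, k.2⟩⟩
    simp

theorem exists_inv_two_pow_lt_le {x C : ℝ≥0} (hx : 0 < x) (hC : x ≤ C) :
    ∃ k : ℕ, 2⁻¹ ^ k < x ∧ x ≤ (C + 2) * 2⁻¹ ^ k := by
  classical
  have hex : ∃ k : ℕ, (2⁻¹ : ℝ≥0) ^ k < x :=
    exists_pow_lt_of_lt_one hx (by norm_num [inv_lt_one_iff₀])
  refine ⟨Nat.find hex, Nat.find_spec hex, ?_⟩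
  cases hk : Nat.find hex with
  | zero => simpa using hC.trans le_self_add
  | succ k =>
    have hle : x ≤ 2⁻¹ ^ k := not_lt.1 (Nat.find_min hex (hk ▸ k.lt_succ_self))
    calc x ≤ 2 * 2⁻¹ ^ (k + 1) := hle.trans_eq (by rw [pow_succ]; field_simp)
      _ ≤ (C + 2) * 2⁻¹ ^ (k + 1) := by gcongr; exact le_add_self

variable {γ β : Type} [Primcodable γ] {G : γ → β → ℝ≥0∞} {C : ℝ≥0}

theorem IsPrefixMachine.tsum_algorithmicProbability_binaryCode_le_one (hU : IsPrefixMachine U) :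
    ∑' c : γ, algorithmicProbability U (binaryCode c) ≤ 1 :=
  (ENNReal.tsum_comp_le_tsum_of_injective binaryCode_injective _).trans
    hU.tsum_algorithmicProbability_le_one

theorem IsPrefixMachine.tsum_inv_two_pow_length_add_le (hU : IsPrefixMachine U)
    (hC : ∀ c, ∑' b, G c b ≤ C) :
    ∑' x : {x : (γ × β) × List Bool × ℕ //
      binaryCode x.1.1 ∈ U x.2.1 ∧ 2⁻¹ ^ x.2.2 < G x.1.1 x.1.2},
        (2⁻¹ : ℝ≥0∞) ^ (x.1.2.1.length + x.1.2.2) ≤ 2 * C := by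
  let weight : (Σ x : γ × β, {π // binaryCode x.1 ∈ U π} × {k : ℕ // 2⁻¹ ^ k < G x.1 x.2}) →
    ℝ≥0∞ := fun y => 2⁻¹ ^ (y.2.1.1.length + y.2.2.1)
  let split : {x : (γ × β) × List Bool × ℕ //
      binaryCode x.1.1 ∈ U x.2.1 ∧ 2⁻¹ ^ x.2.2 < G x.1.1 x.1.2} →
    Σ x : γ × β, {π // binaryCode x.1 ∈ U π} × {k : ℕ // 2⁻¹ ^ k < G x.1 x.2} :=
    fun x => ⟨x.1.1, ⟨x.1.2.1, x.2.1⟩, ⟨x.1.2.2, x.2.2⟩⟩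
  have hsplit : Function.Injective split := by
    rintro ⟨⟨x, π, k⟩, h⟩ ⟨⟨x', π', k'⟩, h'⟩ heq
    obtain ⟨rfl, heq⟩ := Sigma.mk.inj heq
    simp_all
  calc _ ≤ ∑' y, weight y := ENNReal.tsum_comp_le_tsum_of_injective hsplit weight
    _ = ∑' (c : γ) (b : β), algorithmicProbability U (binaryCode c) *
          ∑' k : {k : ℕ // 2⁻¹ ^ k < G c b}, 2⁻¹ ^ k.1 := by
        simp only [weight, ENNReal.tsum_sigma', ENNReal.tsum_prod', pow_add, ENNReal.tsum_mul_left,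
          ENNReal.tsum_mul_right, algorithmicProbability]
    _ ≤ ∑' (c : γ) (b : β), algorithmicProbability U (binaryCode c) * (2 * G c b) := by
        gcongr
        exact tsum_inv_two_pow_lt_le _
    _ = ∑' c : γ, algorithmicProbability U (binaryCode c) * (2 * ∑' b, G c b) := by
        simp only [ENNReal.tsum_mul_left]
    _ ≤ ∑' c : γ, algorithmicProbability U (binaryCode c) * (2 * C) := by
        gcongr
        exact hC _
    _ ≤ 2 * C := by
        rw [ENNReal.tsum_mul_right]
        exact mul_le_of_le_one_left' hU.tsum_algorithmicProbability_binaryCode_le_one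

theorem IsUniversalPrefixMachine.exists_mul_le_twoPowNeg_stringComplexity [Primcodable β]
    (hU : IsUniversalPrefixMachine U)
    (hG : REPred fun x : (γ × β) × ℕ => 2⁻¹ ^ x.2 < G x.1.1 x.1.2)
    (hC : ∀ c, ∑' b, G c b ≤ C) {w : γ → β → List Bool} (hw : Computable₂ w) :
    ∃ α : ℝ≥0, 0 < α ∧ ∀ c b,
      (α * twoPowNeg (stringComplexity U (binaryCode c)) : ℝ≥0) * G c b ≤
        twoPowNeg (stringComplexity U (w c b)) := by
  have hmachine : REPred fun x : (γ × β) × List Bool × ℕ => binaryCode x.1.1 ∈ U x.2.1 :=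
    rePred_comp (rePred_mem_partrec hU.isPrefixMachine.partrec)
      ((Computable.fst.comp Computable.snd).pair
        (primrec_binaryCode.to_comp.comp (Computable.fst.comp Computable.fst)))
  have hweight : REPred fun x : (γ × β) × List Bool × ℕ => 2⁻¹ ^ x.2.2 < G x.1.1 x.1.2 :=
    rePred_comp (f := fun x : (γ × β) × List Bool × ℕ => (x.1, x.2.2)) hG
      (Computable.fst.pair (Computable.snd.comp Computable.snd))
  have hrequest : Computable fun x : (γ × β) × List Bool × ℕ =>
      (x.2.1.length + x.2.2, w x.1.1 x.1.2) :=
    (Primrec.nat_add.to_comp.comp (Computable.list_length.comp (Computable.fst.comp Computable.snd))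
      (Computable.snd.comp Computable.snd)).pair
      (hw.comp (Computable.fst.comp Computable.fst) (Computable.snd.comp Computable.fst))
  obtain ⟨d, hd⟩ := hU.exists_stringComplexity_le_of_computable (rePred_and hmachine hweight)
    hrequest (ne_top_of_le_ne_top (by finiteness)
      (hU.isPrefixMachine.tsum_inv_two_pow_length_add_le hC))
  refine ⟨2⁻¹ ^ d / (C + 2), by positivity, fun c b => ?_⟩
  have hGC : G c b ≤ C := (ENNReal.le_tsum b).trans (hC c)
  lift G c b to ℝ≥0 using ne_top_of_le_ne_top ENNReal.coe_ne_top hGC with y hy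
  obtain rfl | hpos := eq_zero_or_pos y
  · simp
  obtain ⟨k, hk, hyk⟩ := exists_inv_two_pow_lt_le hpos (ENNReal.coe_le_coe.1 hGC)
  obtain ⟨π, hπ, hlen⟩ :=
    exists_mem_length_eq_stringComplexity (hU.stringComplexity_ne_top (binaryCode c))
  have hle : stringComplexity U (w c b) ≤ (π.length + k + d : ℕ) := by
    refine (hd ((c, b), π, k) ⟨hπ, ?_⟩).trans_eq (by push_cast; rfl)
    simpa only [ENNReal.coe_pow, ENNReal.coe_inv_two, hy] using ENNReal.coe_lt_coe.2 hk
  rw [← ENNReal.coe_mul, ENNReal.coe_le_coe, ← hlen, twoPowNeg_coe]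
  calc 2⁻¹ ^ d / (C + 2) * 2⁻¹ ^ π.length * y
      ≤ 2⁻¹ ^ d / (C + 2) * 2⁻¹ ^ π.length * ((C + 2) * 2⁻¹ ^ k) := by gcongr
    _ = 2⁻¹ ^ (π.length + k + d) := by
        rw [pow_add, pow_add]
        field_simp
    _ ≤ twoPowNeg (stringComplexity U (w c b)) := twoPowNeg_antitone hle

end Coding

/-! ### The outer measure `κ` -/

theorem ratCode_injective : Function.Injective ratCode := fun _ _ h =>
  Rat.ext (congrArg Prod.fst h) (congrArg Prod.snd h)

theorem pointCode_injective {n : ℕ} : Function.Injective (pointCode (n := n)) := fun _ _ h =>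
  funext fun i => ratCode_injective (congrFun h i)

theorem ratPoint_injective {n : ℕ} : Function.Injective (ratPoint (n := n)) :=
  (WithLp.toLp_injective 2).comp fun _ _ h => funext fun i => Rat.cast_injective (congrFun h i)

section Kappa

variable {U : List Bool →. List Bool} {n : ℕ}

theorem kappa_apply (E : Set (EuclideanSpace ℝ (Fin n))) :
    kappa U n E = twoPowNeg (setComplexity U E) := rfl

theorem setComplexity_le_pointComplexity {E : Set (EuclideanSpace ℝ (Fin n))} {q : Fin n → ℚ}
    (hq : ratPoint q ∈ E) : setComplexity U E ≤ pointComplexity U q :=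
  iInf₂_le q hq

theorem setComplexity_singleton (q : Fin n → ℚ) :
    setComplexity U {ratPoint q} = pointComplexity U q := by
  simp only [setComplexity, Set.mem_singleton_iff, ratPoint_injective.eq_iff, iInf_iInf_eq_left]

theorem exists_pointComplexity_eq_setComplexity {E : Set (EuclideanSpace ℝ (Fin n))}
    (h : setComplexity U E ≠ ⊤) :
    ∃ q, ratPoint q ∈ E ∧ pointComplexity U q = setComplexity U E := by
  rw [setComplexity, iInf_subtype'] at h ⊢
  have : Nonempty {q : Fin n → ℚ // ratPoint q ∈ E} := by
    by_contra hempty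
    rw [not_nonempty_iff] at hempty
    exact h (iInf_of_empty _)
  obtain ⟨q, hq⟩ := ENat.exists_eq_iInf fun q : {q : Fin n → ℚ // ratPoint q ∈ E} =>
    pointComplexity U q.1
  exact ⟨q.1, q.2, hq⟩

theorem isSupportedOnRat_kappa : IsSupportedOnRat (kappa U n) := by
  have : setComplexity U (Set.range (ratPoint (n := n)))ᶜ = ⊤ := by simp [setComplexity]
  rw [IsSupportedOnRat, kappa_apply, this, twoPowNeg_top, ENNReal.coe_zero]

theorem IsPrefixMachine.isStronglyFinite_kappa (hU : IsPrefixMachine U) :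
    IsStronglyFinite (kappa U n) := by
  refine ⟨isSupportedOnRat_kappa, lt_of_le_of_lt ?_ ENNReal.one_lt_top⟩
  calc ∑' q : Fin n → ℚ, kappa U n {ratPoint q}
      ≤ ∑' q : Fin n → ℚ, algorithmicProbability U (binaryCode (pointCode q)) := by
        refine ENNReal.tsum_le_tsum fun q => ?_
        rw [kappa_apply, setComplexity_singleton]
        exact twoPowNeg_stringComplexity_le_algorithmicProbability _
    _ ≤ ∑' p : Fin n → ℤ × ℕ, algorithmicProbability U (binaryCode p) :=
        ENNReal.tsum_comp_le_tsum_of_injective pointCode_injective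
          fun p => algorithmicProbability U (binaryCode p)
    _ ≤ 1 := hU.tsum_algorithmicProbability_binaryCode_le_one

theorem finite_setOf_stringComplexity_le (k : ℕ) : {w | stringComplexity U w ≤ k}.Finite := by
  have hfinite : (⋃ π ∈ {π : List Bool | π.length ≤ k}, {w | w ∈ U π}).Finite :=
    (List.finite_length_le Bool k).biUnion fun π _ =>
      Set.Subsingleton.finite fun _ hv _ hw => Part.mem_unique hv hw
  refine hfinite.subset fun w hw => ?_
  obtain ⟨π, hπ, hlen⟩ := exists_mem_length_eq_stringComplexity
    (ne_top_of_le_ne_top (ENat.natCast_ne_top k) hw)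
  exact Set.mem_biUnion (show π.length ≤ k by exact_mod_cast hlen.trans_le hw) hπ

theorem isFinitelySupportedOnRat_kappa : IsFinitelySupportedOnRat (kappa U n) := by
  intro ε hε
  obtain ⟨k, hk⟩ := exists_pow_lt_of_lt_one hε (by norm_num [inv_lt_one_iff₀] : (2⁻¹ : ℝ≥0) < 1)
  have hfinite : {q : Fin n → ℚ | pointComplexity U q ≤ k}.Finite :=
    Set.Finite.preimage (f := binaryCode ∘ pointCode)
      (binaryCode_injective.comp pointCode_injective).injOn (finite_setOf_stringComplexity_le k)
  refine ⟨hfinite.toFinset, ?_⟩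
  rw [kappa_apply, ENNReal.coe_lt_coe]
  rw [← twoPowNeg_coe] at hk
  refine lt_of_le_of_lt (twoPowNeg_antitone (le_iInf₂ fun q hq => ?_)) hk
  by_contra! hlt
  exact hq ⟨q, by simpa using hlt.le, rfl⟩

end Kappa

/-! ### Lower semicomputability of `κ` -/

section Stages

variable {α : Type} {D : α × ℕ → ℕ → Prop}

/-- Before stage `t`, the enumeration with stages `D` has revealed a program of length `k` for a
member of `l`. -/
def SeenBefore (D : α × ℕ → ℕ → Prop) (l : List α) (t k : ℕ) : Prop :=
  ∃ p ∈ l, ∃ s < t, D (p, k) s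

open Classical in
/-- The least length `k < t` of a program for a member of `l` revealed before stage `t`; it is `t`
if there is none. -/
noncomputable def stageComplexity (D : α × ℕ → ℕ → Prop) (l : List α) (t : ℕ) : ℕ :=
  (List.range t).findIdx fun k => decide (SeenBefore D l t k)

theorem stageComplexity_le {l : List α} {t k : ℕ} (h : SeenBefore D l t k) :
    stageComplexity D l t ≤ k := by
  classical
  by_contra! hlt
  simpa [h] using List.not_of_lt_findIdx hlt

theorem seenBefore_stageComplexity {l : List α} {t : ℕ} (h : stageComplexity D l t < t) :
    SeenBefore D l t (stageComplexity D l t) := by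
  classical
  have hlt : (List.range t).findIdx (fun k => decide (SeenBefore D l t k)) <
      (List.range t).length := h.trans_eq List.length_range.symm
  have hfound := List.findIdx_getElem (w := hlt)
  rw [List.getElem_range] at hfound
  exact of_decide_eq_true hfound

theorem SeenBefore.mono {l : List α} {s t k : ℕ} (hst : s ≤ t) (h : SeenBefore D l s k) :
    SeenBefore D l t k := by
  obtain ⟨p, hp, i, hi, hD⟩ := h
  exact ⟨p, hp, i, hi.trans_le hst, hD⟩

theorem stageComplexity_congr {l l' : List α} (h : ∀ p, p ∈ l ↔ p ∈ l') (t : ℕ) :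
    stageComplexity D l t = stageComplexity D l' t := by
  have hseen : ∀ k, SeenBefore D l t k ↔ SeenBefore D l' t k := fun k => by
    simp only [SeenBefore, h]
  exact congrArg (fun p => List.findIdx p _) (funext fun k => decide_eq_decide.2 (hseen k))

theorem primrec_stageComplexity [Primcodable α] (hD : PrimrecRel D) :
    Primrec₂ (stageComplexity D) := by
  classical
  have hstage : PrimrecRel fun (p : α) (x : ℕ × ℕ) => ∃ s ∈ List.range x.1, D (p, x.2) s :=
    (PrimrecRel.exists_mem_list (R := fun (s : ℕ) (x : α × ℕ) => D x s)
      (hD.comp Primrec.snd Primrec.fst)).comp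
      (Primrec.list_range.comp (Primrec.fst.comp Primrec.snd))
      (Primrec.fst.pair (Primrec.snd.comp Primrec.snd))
  have hseen : PrimrecRel fun (x : List α × ℕ) (k : ℕ) => SeenBefore D x.1 x.2 k :=
    (hstage.exists_mem_list.comp (Primrec.fst.comp Primrec.fst)
      ((Primrec.snd.comp Primrec.fst).pair Primrec.snd)).of_eq fun x => by
        simp only [SeenBefore, List.mem_range]
  exact Primrec.list_findIdx (Primrec.list_range.comp Primrec.snd) hseen.decide

end Stages

section LowerSemicomputable

variable {n : ℕ} {D : (Fin n → ℤ × ℕ) × ℕ → ℕ → Prop}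

/-- The lower bound for `κ(A)` known before stage `t`. -/
noncomputable def stageKappa (D : (Fin n → ℤ × ℕ) × ℕ → ℕ → Prop) (A : Finset (Fin n → ℚ))
    (t : ℕ) : ℚ≥0 :=
  if stageComplexity D (A.toList.map pointCode) t < t then
    (2 ^ stageComplexity D (A.toList.map pointCode) t)⁻¹ else 0

theorem ratCode_inv_two_pow (k : ℕ) : ratCode ((2 ^ k)⁻¹) = (1, 2 ^ k) := by
  rw [← Nat.cast_ofNat, ← Nat.cast_pow, ratCode, Rat.inv_natCast_num_of_pos (by positivity),
    Rat.inv_natCast_den_of_pos (by positivity)]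

theorem isComputableOnFinsets_stageKappa (hD : PrimrecRel D) :
    IsComputableOnFinsets (stageKappa D) := by
  have hstage := primrec_stageComplexity hD
  refine ⟨fun l t => if stageComplexity D l t < t then (1, 2 ^ stageComplexity D l t) else (0, 1),
    (Primrec.ite (Primrec.nat_lt.comp hstage Primrec.snd)
      ((Primrec.const 1).pair (primrec_nat_pow.comp (Primrec.const 2) hstage))
      (Primrec.const (0, 1))).to_comp, fun l t => ?_⟩
  have hcongr : stageComplexity D (l.toFinset.toList.map pointCode) t =
      stageComplexity D (l.map pointCode) t := stageComplexity_congr (by simp) t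
  simp only [stageKappa, hcongr]
  split_ifs
  · push_cast
    exact (ratCode_inv_two_pow _).symm
  · rfl

theorem stageKappa_mono (A : Finset (Fin n → ℚ)) : Monotone (stageKappa D A) := by
  intro s t hst
  unfold stageKappa
  split_ifs with hs ht ht
  · have := stageComplexity_le ((seenBefore_stageComplexity hs).mono hst)
    gcongr
    norm_num
  · exact absurd ((stageComplexity_le ((seenBefore_stageComplexity hs).mono hst)).trans_lt
      (hs.trans_le hst)) ht
  · exact zero_le
  · exact le_rfl

theorem coe_stageKappa {A : Finset (Fin n → ℚ)} {t : ℕ}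
    (h : stageComplexity D (A.toList.map pointCode) t < t) :
    (stageKappa D A t : ℝ≥0) = twoPowNeg (stageComplexity D (A.toList.map pointCode) t) := by
  rw [stageKappa, if_pos h, twoPowNeg_coe, inv_pow]
  push_cast
  rfl

variable {U : List Bool →. List Bool}

theorem stageKappa_le_kappa
    (hD : ∀ p k t, D (p, k) t → ∃ π, π.length = k ∧ binaryCode p ∈ U π)
    (A : Finset (Fin n → ℚ)) (t : ℕ) :
    ((stageKappa D A t : ℝ≥0) : ℝ≥0∞) ≤ kappa U n (ratPoint '' (A : Set (Fin n → ℚ))) := by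
  by_cases ht : stageComplexity D (A.toList.map pointCode) t < t
  · obtain ⟨p, hp, s, -, hs⟩ := seenBefore_stageComplexity ht
    obtain ⟨q, hq, rfl⟩ := List.mem_map.1 hp
    obtain ⟨π, hlen, hπ⟩ := hD _ _ _ hs
    rw [coe_stageKappa ht, kappa_apply, ENNReal.coe_le_coe, ← hlen]
    exact twoPowNeg_antitone ((setComplexity_le_pointComplexity
      (Set.mem_image_of_mem _ (by simpa using hq))).trans (stringComplexity_le hπ))
  · simp [stageKappa, ht]

theorem tendsto_stageKappa
    (hD : ∀ p k, (∃ t, D (p, k) t) ↔ ∃ π, π.length = k ∧ binaryCode p ∈ U π)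
    (A : Finset (Fin n → ℚ)) :
    Tendsto (fun t => ((stageKappa D A t : ℝ≥0) : ℝ≥0∞)) atTop
      (𝓝 (kappa U n (ratPoint '' (A : Set (Fin n → ℚ))))) := by
  have hle := stageKappa_le_kappa (fun p k t h => (hD p k).1 ⟨t, h⟩) A
  refine tendsto_const_nhds.congr' (f₁ := fun _ => kappa U n (ratPoint '' (A : Set (Fin n → ℚ)))) ?_
  by_cases htop : setComplexity U (ratPoint '' (A : Set (Fin n → ℚ))) = ⊤
  · refine Eventually.of_forall fun t => (hle t).antisymm' ?_
    simp [kappa_apply, htop, twoPowNeg_top]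
  obtain ⟨_, ⟨q, hq, hqq⟩, hqK⟩ := exists_pointComplexity_eq_setComplexity htop
  obtain rfl := ratPoint_injective hqq
  obtain ⟨π, hπ, hlen⟩ := exists_mem_length_eq_stringComplexity (hqK.trans_ne htop)
  obtain ⟨s, hs⟩ := (hD _ _).2 ⟨π, rfl, hπ⟩
  filter_upwards [eventually_gt_atTop s, eventually_gt_atTop π.length] with t hst hπt
  have hstage : stageComplexity D (A.toList.map pointCode) t ≤ π.length :=
    stageComplexity_le ⟨pointCode q, List.mem_map.2 ⟨q, by simpa using hq, rfl⟩, s, hst, hs⟩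
  refine (hle t).antisymm' ?_
  rw [coe_stageKappa (hstage.trans_lt hπt), kappa_apply, ENNReal.coe_le_coe, ← hqK,
    pointComplexity, ← hlen]
  exact twoPowNeg_antitone (by exact_mod_cast hstage)

theorem isLowerSemicomputable_kappa (hU : Partrec U) : IsLowerSemicomputable (kappa U n) := by
  have hlength : REPred fun x : ((Fin n → ℤ × ℕ) × ℕ) × List Bool => x.2.length = x.1.2 :=
    (Primrec.eq.comp (Primrec.list_length.comp Primrec.snd)
      (Primrec.snd.comp Primrec.fst)).computablePred.to_re
  have hprogram : REPred fun x : ((Fin n → ℤ × ℕ) × ℕ) × List Bool => binaryCode x.1.1 ∈ U x.2 :=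
    rePred_comp (rePred_mem_partrec hU) (Primrec.snd.pair
      (primrec_binaryCode.comp (Primrec.fst.comp Primrec.fst))).to_comp
  obtain ⟨D, hD, hmem⟩ := exists_primrecRel_of_rePred (rePred_exists
    (p := fun (x : (Fin n → ℤ × ℕ) × ℕ) π => π.length = x.2 ∧ binaryCode x.1 ∈ U π)
    (rePred_and hlength hprogram))
  have hstages : ∀ p k, (∃ t, D (p, k) t) ↔ ∃ π, π.length = k ∧ binaryCode p ∈ U π :=
    fun p k => (hmem (p, k)).symm
  exact ⟨isFinitelySupportedOnRat_kappa, stageKappa D, isComputableOnFinsets_stageKappa hD,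
    fun A s t hst => ⟨stageKappa_mono A hst,
      stageKappa_le_kappa (fun p k t h => (hstages p k).1 ⟨t, h⟩) A t⟩,
    tendsto_stageKappa hstages⟩

end LowerSemicomputable

/-! ### Outer measures carried by the rational points -/

section OuterMeasure

variable {n : ℕ} {ν : OuterMeasure (EuclideanSpace ℝ (Fin n))}

theorem IsSupportedOnRat.le_tsum_singleton (hν : IsSupportedOnRat ν)
    (E : Set (EuclideanSpace ℝ (Fin n))) :
    ν E ≤ ∑' q : {q : Fin n → ℚ // ratPoint q ∈ E}, ν {ratPoint q.1} := by
  have hcover : E ⊆ (Set.range (ratPoint (n := n)))ᶜ ∪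
      ⋃ q : {q : Fin n → ℚ // ratPoint q ∈ E}, {ratPoint q.1} := by
    intro x hx
    by_cases hr : x ∈ Set.range (ratPoint (n := n))
    · obtain ⟨q, rfl⟩ := hr
      exact Or.inr (Set.mem_iUnion.2 ⟨⟨q, hx⟩, rfl⟩)
    · exact Or.inl hr
  calc ν E ≤ ν (Set.range (ratPoint (n := n)))ᶜ +
        ν (⋃ q : {q : Fin n → ℚ // ratPoint q ∈ E}, {ratPoint q.1}) :=
        (measure_mono hcover).trans (measure_union_le _ _)
    _ = ν (⋃ q : {q : Fin n → ℚ // ratPoint q ∈ E}, {ratPoint q.1}) := by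
        rw [show ν (Set.range (ratPoint (n := n)))ᶜ = 0 from hν, zero_add]
    _ ≤ _ := measure_iUnion_le _

theorem IsSupportedOnRat.tsum_le_tsum_singleton (hν : IsSupportedOnRat ν) {β : Type*}
    {E : β → Set (EuclideanSpace ℝ (Fin n))} (hE : Pairwise (Function.onFun Disjoint E)) :
    ∑' b, ν (E b) ≤ ∑' q : Fin n → ℚ, ν {ratPoint q} := by
  have hinj : Function.Injective
      fun x : Σ b, {q : Fin n → ℚ // ratPoint q ∈ E b} => x.2.1 := by
    rintro ⟨b, q, hq⟩ ⟨b', q', hq'⟩ rfl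
    obtain rfl : b = b' := by
      by_contra hb
      exact Set.disjoint_left.1 (hE hb) hq hq'
    rfl
  calc ∑' b, ν (E b)
      ≤ ∑' (b) (q : {q : Fin n → ℚ // ratPoint q ∈ E b}), ν {ratPoint q.1} :=
        ENNReal.tsum_le_tsum fun b => hν.le_tsum_singleton (E b)
    _ = ∑' x : Σ b, {q : Fin n → ℚ // ratPoint q ∈ E b}, ν {ratPoint x.2.1} :=
        (ENNReal.tsum_sigma _).symm
    _ ≤ ∑' q : Fin n → ℚ, ν {ratPoint q} :=
        ENNReal.tsum_comp_le_tsum_of_injective hinj fun q => ν {ratPoint q}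

theorem IsFinitelySupportedOnRat.exists_finset_lt (hν : IsFinitelySupportedOnRat ν)
    {E : Set (EuclideanSpace ℝ (Fin n))} {y : ℝ≥0∞} (hy : y < ν E) :
    ∃ A : Finset (Fin n → ℚ), (∀ q ∈ A, ratPoint q ∈ E) ∧
      y < ν (ratPoint '' (A : Set (Fin n → ℚ))) := by
  classical
  obtain ⟨ε, hε, hyε⟩ := ENNReal.lt_iff_exists_add_pos_lt.1 hy
  obtain ⟨B, hB⟩ := hν ε hε
  refine ⟨B.filter fun q => ratPoint q ∈ E, fun q hq => (Finset.mem_filter.1 hq).2, ?_⟩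
  have hcover : E ⊆ ratPoint '' ((B.filter fun q => ratPoint q ∈ E : Finset (Fin n → ℚ)) :
      Set (Fin n → ℚ)) ∪ (ratPoint '' (B : Set (Fin n → ℚ)))ᶜ := by
    intro x hx
    by_cases h : x ∈ ratPoint '' (B : Set (Fin n → ℚ))
    · obtain ⟨q, hq, rfl⟩ := h
      exact Or.inl ⟨q, by simpa using ⟨hq, hx⟩, rfl⟩
    · exact Or.inr h
  have hle := (measure_mono (μ := ν) hcover).trans (measure_union_le _ _)
  exact lt_of_add_lt_add_right (hyε.trans_le (hle.trans (by gcongr)))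

end OuterMeasure

/-! ### Fractions that need not be reduced -/

section Fractions

/-- The rational point with the given coordinates, as fractions that need not be reduced; a zero
denominator gives the coordinate `0`. Unlike the reduced codes of rational points, all such
tuples are admitted, so that algorithms can enumerate them. -/
def fracPoint {n : ℕ} (p : Fin n → ℤ × ℕ) : Fin n → ℚ := fun i => (p i).1 / (p i).2

theorem fracPoint_pointCode {n : ℕ} (q : Fin n → ℚ) : fracPoint (pointCode q) = q :=
  funext fun i => Rat.num_div_den (q i)

theorem ratCode_div {a : ℤ} {b : ℕ} (hb : b ≠ 0) :
    ratCode (a / b : ℚ) = (a / (Nat.gcd a.natAbs b : ℕ), b / Nat.gcd a.natAbs b) := by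
  rw [← Rat.mkRat_eq_div, ← Rat.normalize_eq_mkRat hb, Rat.normalize_eq, ratCode]

theorem primrec_ratCode_div : Primrec fun p : ℤ × ℕ => ratCode (p.1 / p.2 : ℚ) := by
  have hgcd : Primrec fun p : ℤ × ℕ => Nat.gcd p.1.natAbs p.2 :=
    primrec_nat_gcd.comp (primrec_int_natAbs.comp Primrec.fst) Primrec.snd
  refine (Primrec.ite (Primrec.eq.comp Primrec.snd (Primrec.const 0)) (Primrec.const (0, 1))
    ((primrec_int_div_nat.comp Primrec.fst hgcd).pair
      (Primrec.nat_div.comp Primrec.snd hgcd))).of_eq fun p => ?_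
  split_ifs with hp
  · simp [hp, ratCode]
  · exact (ratCode_div hp).symm

theorem primrec_pointCode_fracPoint {n : ℕ} :
    Primrec fun p : Fin n → ℤ × ℕ => pointCode (fracPoint p) :=
  Primrec.fin_curry.2 (primrec_ratCode_div.comp Primrec.fin_app)

theorem inv_two_pow_lt_iff_ratCode (k : ℕ) (x : ℚ≥0) :
    2⁻¹ ^ k < ((x : ℝ≥0) : ℝ≥0∞) ↔ (ratCode x).2 < (ratCode x).1.toNat * 2 ^ k := by
  have hcode : ratCode x = ((x.num : ℤ), x.den) := by
    rw [ratCode, NNRat.num_coe, NNRat.den_coe]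
  have hden : (0 : ℝ≥0) < x.den := by exact_mod_cast x.den_pos
  rw [← coe_twoPowNeg_natCast, ENNReal.coe_lt_coe, twoPowNeg_coe, hcode, Int.toNat_natCast,
    NNRat.cast_def, inv_pow, lt_div_iff₀ hden, inv_mul_lt_iff₀ (by positivity), mul_comm]
  exact_mod_cast Iff.rfl

end Fractions

/-! ### Dyadic cubes -/

section DyadicCubes

variable {n : ℕ}

theorem mem_dyadicCube_iff_floor {r : ℕ} {m : Fin n → ℤ} {x : EuclideanSpace ℝ (Fin n)} :
    x ∈ dyadicCube r m ↔ ∀ i, ⌊x i * 2 ^ r⌋ = m i := by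
  have hpos : (2 : ℝ) ^ r ≠ 0 := by positivity
  simp only [Int.floor_eq_iff]
  constructor
  · rintro ⟨y, hy, rfl⟩ i
    have : (((2 : ℝ) ^ r)⁻¹ • y) i * 2 ^ r = y i := by
      simp only [PiLp.smul_apply, smul_eq_mul]
      field_simp
    rw [this]
    exact hy i
  · intro h
    refine ⟨(2 : ℝ) ^ r • x, fun i => ?_, by simp [smul_smul, hpos]⟩
    simpa [mul_comm] using h i

theorem pairwise_disjoint_dyadicCube (r : ℕ) :
    Pairwise (Function.onFun Disjoint (dyadicCube (n := n) r)) := by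
  intro m m' hm
  refine Set.disjoint_left.2 fun x hx hx' => hm (funext fun i => ?_)
  rw [← mem_dyadicCube_iff_floor.1 hx i, mem_dyadicCube_iff_floor.1 hx' i]

theorem ratPoint_fracPoint_mem_dyadicCube {r : ℕ} {m : Fin n → ℤ} {p : Fin n → ℤ × ℕ} :
    ratPoint (fracPoint p) ∈ dyadicCube r m ↔ ∀ i, (p i).1 * (2 ^ r : ℕ) / (p i).2 = m i := by
  rw [mem_dyadicCube_iff_floor]
  refine forall_congr' fun i => ?_
  have hcast : (ratPoint (fracPoint p) i * 2 ^ r : ℝ) =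
      ((((p i).1 * (2 ^ r : ℕ) : ℤ) / (p i).2 : ℚ) : ℝ) := by
    simp only [ratPoint, fracPoint]
    push_cast
    ring
  rw [hcast, Rat.floor_cast, Rat.floor_intCast_div_natCast]

theorem primrecPred_forall_fin {α : Type*} [Primcodable α] {n : ℕ} {R : Fin n → α → Prop}
    (h : ∀ i, PrimrecPred (R i)) : PrimrecPred fun a => ∀ i, R i a := by
  induction n with
  | zero =>
    exact (Primrec.eq.comp (Primrec.const (α := α) ()) (Primrec.const ())).of_eq fun a => by simp
  | succ n ih =>
    exact ((h 0).and (ih fun i => h i.succ)).of_eq fun a =>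
      (Fin.forall_fin_succ (P := fun i => R i a)).symm

theorem primrecRel_ratPoint_fracPoint_mem_dyadicCube :
    PrimrecRel fun (p : Fin n → ℤ × ℕ) (c : ℕ × (Fin n → ℤ)) =>
      ratPoint (fracPoint p) ∈ dyadicCube c.1 c.2 := by
  have hcoord : ∀ i : Fin n, PrimrecPred fun x : (Fin n → ℤ × ℕ) × ℕ × (Fin n → ℤ) =>
      (x.1 i).1 * (2 ^ x.2.1 : ℕ) / (x.1 i).2 = x.2.2 i := fun i => by
    have hp : Primrec fun x : (Fin n → ℤ × ℕ) × ℕ × (Fin n → ℤ) => x.1 i :=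
      Primrec.fin_app.comp Primrec.fst (Primrec.const i)
    have hpow : Primrec fun x : (Fin n → ℤ × ℕ) × ℕ × (Fin n → ℤ) => 2 ^ x.2.1 :=
      primrec_nat_pow.comp (Primrec.const 2) (Primrec.fst.comp Primrec.snd)
    exact Primrec.eq.comp
      (primrec_int_div_nat.comp (primrec_int_mul_nat.comp (Primrec.fst.comp hp) hpow)
        (Primrec.snd.comp hp))
      (Primrec.fin_app.comp (Primrec.snd.comp Primrec.snd) (Primrec.const i))
  exact (primrecPred_forall_fin hcoord).of_eq fun x => ratPoint_fracPoint_mem_dyadicCube.symm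

/-- The least corner of the `r`-dyadic cube with address `m`. -/
def cubeCorner (r : ℕ) (m : Fin n → ℤ) : Fin n → ℚ := fracPoint fun i => (m i, 2 ^ r)

theorem ratPoint_cubeCorner_mem_dyadicCube (r : ℕ) (m : Fin n → ℤ) :
    ratPoint (cubeCorner r m) ∈ dyadicCube r m :=
  ratPoint_fracPoint_mem_dyadicCube.2 fun i => Int.mul_ediv_cancel _ (by positivity)

theorem primrec_pointCode_cubeCorner :
    Primrec₂ fun r (m : Fin n → ℤ) => pointCode (cubeCorner r m) := by
  refine primrec_pointCode_fracPoint.comp (Primrec.fin_curry.2 ?_)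
  exact (Primrec.fin_app.comp (Primrec.snd.comp Primrec.fst) Primrec.snd).pair
    (primrec_nat_pow.comp (Primrec.const 2) (Primrec.fst.comp Primrec.fst))

end DyadicCubes

section LowerSemicomputable

variable {n : ℕ} {ν : OuterMeasure (EuclideanSpace ℝ (Fin n))}

theorem IsFinitelySupportedOnRat.lt_iff_exists_fracPoint_lt (hν : IsFinitelySupportedOnRat ν)
    {f : Finset (Fin n → ℚ) → ℕ → ℚ≥0}
    (hle : ∀ A t, ((f A t : ℝ≥0) : ℝ≥0∞) ≤ ν (ratPoint '' (A : Set (Fin n → ℚ))))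
    (hlim : ∀ A : Finset (Fin n → ℚ), Tendsto (fun t => ((f A t : ℝ≥0) : ℝ≥0∞)) atTop
      (𝓝 (ν (ratPoint '' (A : Set (Fin n → ℚ))))))
    (E : Set (EuclideanSpace ℝ (Fin n))) (y : ℝ≥0∞) :
    y < ν E ↔ ∃ x : List (Fin n → ℤ × ℕ) × ℕ, (∀ p ∈ x.1, ratPoint (fracPoint p) ∈ E) ∧
      y < ((f (x.1.map fracPoint).toFinset x.2 : ℝ≥0) : ℝ≥0∞) := by
  constructor
  · intro hy
    obtain ⟨A, hAE, hA⟩ := hν.exists_finset_lt hy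
    obtain ⟨t, ht⟩ := ((hlim A).eventually (lt_mem_nhds hA)).exists
    refine ⟨(A.toList.map pointCode, t), ?_, ?_⟩
    · simpa [fracPoint_pointCode] using hAE
    · have hAlist : (A.toList.map pointCode).map fracPoint = A.toList := by
        simp [Function.comp_def, fracPoint_pointCode]
      rwa [hAlist, Finset.toList_toFinset]
  · rintro ⟨⟨l, t⟩, hl, hy⟩
    refine hy.trans_le ((hle _ t).trans (measure_mono ?_))
    rintro _ ⟨q, hq, rfl⟩
    obtain ⟨p, hp, rfl⟩ := List.mem_map.1 (List.mem_toFinset.1 hq)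
    exact hl p hp

theorem IsLowerSemicomputable.rePred_inv_two_pow_lt {γ : Type} [Primcodable γ]
    (hν : IsLowerSemicomputable ν) {E : γ → Set (EuclideanSpace ℝ (Fin n))}
    (hE : PrimrecRel fun (p : Fin n → ℤ × ℕ) c => ratPoint (fracPoint p) ∈ E c) :
    REPred fun x : γ × ℕ => 2⁻¹ ^ x.2 < ν (E x.1) := by
  obtain ⟨hfin, f, ⟨F, hF, hFf⟩, hmono, hlim⟩ := hν
  have hmem : REPred fun x : (γ × ℕ) × List (Fin n → ℤ × ℕ) × ℕ =>
      ∀ p ∈ x.2.1, ratPoint (fracPoint p) ∈ E x.1.1 :=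
    (hE.forall_mem_list.comp (Primrec.fst.comp Primrec.snd)
      (Primrec.fst.comp Primrec.fst)).computablePred.to_re
  have hlt : REPred fun x : (γ × ℕ) × List (Fin n → ℤ × ℕ) × ℕ =>
      2⁻¹ ^ x.1.2 < ((f (x.2.1.map fracPoint).toFinset x.2.2 : ℝ≥0) : ℝ≥0∞) := by
    have hcode : Computable fun x : (γ × ℕ) × List (Fin n → ℤ × ℕ) × ℕ =>
        (F (x.2.1.map fun p => pointCode (fracPoint p)) x.2.2, x.1.2) :=
      (hF.comp (Primrec.list_map (Primrec.fst.comp Primrec.snd)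
        (primrec_pointCode_fracPoint.comp Primrec.snd).to₂).to_comp
        (Computable.snd.comp Computable.snd)).pair (Computable.snd.comp Computable.fst)
    have hcmp : PrimrecPred fun c : (ℤ × ℕ) × ℕ => c.1.2 < c.1.1.toNat * 2 ^ c.2 :=
      Primrec.nat_lt.comp (Primrec.snd.comp Primrec.fst)
        (Primrec.nat_mul.comp (primrec_int_toNat.comp (Primrec.fst.comp Primrec.fst))
          (primrec_nat_pow.comp (Primrec.const 2) Primrec.snd))
    refine (rePred_comp hcmp.computablePred.to_re hcode).of_eq fun x => ?_
    rw [inv_two_pow_lt_iff_ratCode, ← hFf, List.map_map]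
    rfl
  exact (rePred_exists (p := fun (x : γ × ℕ) (y : List (Fin n → ℤ × ℕ) × ℕ) =>
    (∀ p ∈ y.1, ratPoint (fracPoint p) ∈ E x.1) ∧
      2⁻¹ ^ x.2 < ((f (y.1.map fracPoint).toFinset y.2 : ℝ≥0) : ℝ≥0∞))
    (rePred_and hmem hlt)).of_eq fun x =>
      (hfin.lt_iff_exists_fracPoint_lt (fun A t => (hmono A t t le_rfl).2) hlim
        (E x.1) _).symm

end LowerSemicomputable

/-! ### Domination -/

section Domination

variable {U : List Bool →. List Bool} {n : ℕ} {ν : OuterMeasure (EuclideanSpace ℝ (Fin n))}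

theorem IsUniversalPrefixMachine.twoPowNeg_natComplexity (hU : IsUniversalPrefixMachine U)
    (r : ℕ) : twoPowNeg (natComplexity U r) = 2⁻¹ ^ (natComplexity U r).toNat := by
  rw [← twoPowNeg_coe, natComplexity, ENat.natCast_toNat (hU.stringComplexity_ne_top _)]

theorem IsUniversalPrefixMachine.exists_mul_twoPowNeg_natComplexity_eq_rpow
    (hU : IsUniversalPrefixMachine U) {α : ℝ≥0} (hα : 0 < α) :
    ∃ g : ℕ → ℝ, g =o[atTop] (fun r : ℕ => (r : ℝ)) ∧
      ∀ r, ((α * twoPowNeg (natComplexity U r) : ℝ≥0) : ℝ) = (2 : ℝ) ^ (-g r) := by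
  refine ⟨fun r => (natComplexity U r).toNat - Real.logb 2 α, hU.isLittleO_natComplexity.sub
    ((isLittleO_const_id_atTop (Real.logb 2 α)).comp_tendsto tendsto_natCast_atTop_atTop),
    fun r => ?_⟩
  rw [neg_sub, Real.rpow_sub two_pos, Real.rpow_logb two_pos (by norm_num) (by exact_mod_cast hα),
    Real.rpow_natCast, hU.twoPowNeg_natComplexity]
  push_cast
  rw [inv_pow, div_eq_mul_inv]

theorem IsUniversalPrefixMachine.exists_mul_le_twoPowNeg_pointComplexity_cubeCorner
    (hU : IsUniversalPrefixMachine U) (hν : IsStronglyFinite ν) (hν' : IsLowerSemicomputable ν) :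
    ∃ α : ℝ≥0, 0 < α ∧ ∀ r (m : Fin n → ℤ),
      (α * twoPowNeg (natComplexity U r) : ℝ≥0) * ν (dyadicCube r m) ≤
        twoPowNeg (pointComplexity U (cubeCorner r m)) := by
  refine hU.exists_mul_le_twoPowNeg_stringComplexity
    (G := fun r m => ν (dyadicCube r m)) (C := (∑' q, ν {ratPoint q}).toNNReal)
    (rePred_comp (hν'.rePred_inv_two_pow_lt primrecRel_ratPoint_fracPoint_mem_dyadicCube)
      Computable.id) (fun r => ?_) (primrec_binaryCode.comp primrec_pointCode_cubeCorner).to_comp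
  rw [ENNReal.coe_toNNReal hν.2.ne]
  exact hν.1.tsum_le_tsum_singleton (pairwise_disjoint_dyadicCube r)

theorem IsUniversalPrefixMachine.exists_dominatesWith_kappa
    (hU : IsUniversalPrefixMachine U) (hν : IsStronglyFinite ν) (hν' : IsLowerSemicomputable ν) :
    ∃ α : ℝ≥0, 0 < α ∧ DominatesWith (fun r => α * twoPowNeg (natComplexity U r)) (kappa U n) ν
      (dyadicCubes n) := by
  obtain ⟨α, hα, hcorner⟩ :=
    hU.exists_mul_le_twoPowNeg_pointComplexity_cubeCorner hν hν'
  refine ⟨α, hα, fun r => ?_, hU.exists_mul_twoPowNeg_natComplexity_eq_rpow hα, ?_⟩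
  · beta_reduce
    rw [hU.twoPowNeg_natComplexity]
    positivity
  · rintro r _ ⟨m, rfl⟩
    refine (hcorner r m).trans (ENNReal.coe_le_coe.2 (twoPowNeg_antitone ?_))
    exact setComplexity_le_pointComplexity (ratPoint_cubeCorner_mem_dyadicCube r m)

end Domination

end KolmogorovOuter

theorem mainTheorem2 (n : ℕ) (U : List Bool →. List Bool)
    (hU : KolmogorovOuter.IsUniversalPrefixMachine U) :
    KolmogorovOuter.IsLocallyOptimal (KolmogorovOuter.kappa U n) ∧
    ∃ c : ℕ, ∀ ν : OuterMeasure (EuclideanSpace ℝ (Fin n)),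
      KolmogorovOuter.IsStronglyFinite ν → KolmogorovOuter.IsLowerSemicomputable ν →
      ∃ α : ℝ≥0, 0 < α ∧
        KolmogorovOuter.DominatesWith
          (fun r => α * KolmogorovOuter.twoPowNeg (KolmogorovOuter.natComplexity U r + c))
          (KolmogorovOuter.kappa U n) ν (KolmogorovOuter.dyadicCubes n) := by
  refine ⟨⟨⟨hU.isPrefixMachine.isStronglyFinite_kappa,
    KolmogorovOuter.isLowerSemicomputable_kappa hU.isPrefixMachine.partrec⟩,
    fun ν hν hν' => ?_⟩, 0, fun ν hν hν' => ?_⟩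
  · obtain ⟨α, -, hdom⟩ := hU.exists_dominatesWith_kappa hν hν'
    exact ⟨_, hdom⟩
  · obtain ⟨α, hα, hdom⟩ := hU.exists_dominatesWith_kappa hν hν'
    exact ⟨α, hα, by simpa only [Nat.cast_zero, add_zero] using hdom⟩
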